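/- Let $K$ be a number field with ring of integers $\mathcal O_K$. A hermitian vector bundle $\overline E=(E,(\|\cdot\|_\sigma)_\sigma)$ over $\operatorname{Spec}\mathcal O_K$ is a finitely generated projective $\mathcal O_K$-module $E$ with, for every field embedding $\sigma:K\hookrightarrow\mathbb C$, a hermitian norm $\|\cdot\|_\sigma$ on $E_\sigma=\mathbb C\otimes_{\sigma,\mathcal O_K}E$, the family being invariant under complex conjugation; tensor products, duals, exterior powers and $\mathcal O_K$-submodules carry the usual induced hermitian structures. For a hermitian line bundle $\overline L$ put $\widehat{\deg}\,\overline L=\log\#(L/\mathcal O_K s)-\sum_\sigma\log\|s\|_\sigma$ (for any $0\neq s\in L$), and for $\overline E$ of rank $r$ put $\widehat{\deg}\,\overline E=\widehat{\deg}\,\Lambda^{r}\overline E$, $\widehat{\deg}_n\overline E=\widehat{\deg}\,\overline E/[K:\mathbb Q]$ and, if $r>0$, $\widehat\mu(\overline E)=\widehat{\deg}_n\overline E/r$. For $\overline E$ of positive rank, let $\widehat\mu_{\max}(\overline E)$ be the maximum (supremum) of $\widehat\mu(\overline N)$ over the $\mathcal O_K$-submodules $N\subseteq E$ of positive rank with the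 induced metrics, let $\widehat\mu_{\min}(\overline E)=-\widehat\mu_{\max}(\overline E^\vee)$, and let $\mathrm{u}\widehat{\deg}_n\,\overline E$ be the maximum (supremum) of $\widehat{\deg}_n\overline L$ over the $\mathcal O_K$-submodules $L\subseteq E$ of rank one with the induced metrics. Then for any two hermitian vector bundles $\overline F$ and $\overline G$ of positive rank over $\operatorname{Spec}\mathcal O_K$ the suprema $\widehat\mu_{\max}(\overline F)$, $\widehat\mu_{\max}(\overline G)$, $\widehat\mu_{\max}(\overline G^\vee)$, $\mathrm{u}\widehat{\deg}_n(\overline F\otimes\overline G^\vee)$ and $\mathrm{u}\widehat{\deg}_n(\overline F\otimes\overline G)$ are finite, and $$\mathrm{u}\widehat{\deg}_n(\overline F\otimes\overline G^\vee)\le\widehat\mu_{\max}(\overline F)-\widehat\mu_{\min}(\overline G),\qquad \mathrm{u}\widehat{\deg}_n(\overline F\otimes\overline G)\le\widehat\mu_{\max}(\overline F)+\widehat\mu_{\max}(\overline G).$$ -/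

import Mathlib

open NumberField

namespace Arakelov

open TensorProduct

set_option linter.style.haveILetI false
set_option linter.unusedSectionVars false

section InnerProducts

variable {𝕜 V W : Type*} [RCLike 𝕜] [AddCommGroup V] [Module 𝕜 V] [AddCommGroup W] [Module 𝕜 W]

/-- The restriction of an inner product along an injective linear map. -/
@[reducible] noncomputable def coreComap (c : InnerProductSpace.Core 𝕜 W) (f : V →ₗ[𝕜] W)
    (hf : Function.Injective f) : InnerProductSpace.Core 𝕜 V where
  inner x y := c.inner (f x) (f y)
  conj_inner_symm x y := c.conj_inner_symm (f x) (f y)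
  re_inner_nonneg x := c.re_inner_nonneg (f x)
  add_left x y z := by rw [map_add]; exact c.add_left _ _ _
  smul_left x y r := by rw [map_smul]; exact c.smul_left _ _ _
  definite x hx := (map_eq_zero_iff f hf).mp (c.definite _ hx)

/-- The inner product on `V ⊗ W` with `⟪a ⊗ b, a' ⊗ b'⟫ = ⟪a, a'⟫ * ⟪b, b'⟫`. -/
@[reducible] noncomputable def coreTensor (c : InnerProductSpace.Core 𝕜 V) (d : InnerProductSpace.Core 𝕜 W) :
    InnerProductSpace.Core 𝕜 (V ⊗[𝕜] W) :=
  letI := c.toNormedAddCommGroup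
  letI := InnerProductSpace.ofCore c.toCore
  letI := d.toNormedAddCommGroup
  letI := InnerProductSpace.ofCore d.toCore
  InnerProductSpace.toCore (𝕜 := 𝕜) (E := V ⊗[𝕜] W)

theorem coreTensor_tmul (c : InnerProductSpace.Core 𝕜 V) (d : InnerProductSpace.Core 𝕜 W)
    (a a' : V) (b b' : W) :
    (coreTensor c d).inner (a ⊗ₜ b) (a' ⊗ₜ b') = c.inner a a' * d.inner b b' := rfl

theorem core_add_right (c : InnerProductSpace.Core 𝕜 V) (x y z : V) :
    c.inner x (y + z) = c.inner x y + c.inner x z := by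
  letI := c.toNormedAddCommGroup
  letI := InnerProductSpace.ofCore c.toCore
  exact inner_add_right x y z

theorem core_smul_right (c : InnerProductSpace.Core 𝕜 V) (x y : V) (r : 𝕜) :
    c.inner x (r • y) = r * c.inner x y := by
  letI := c.toNormedAddCommGroup
  letI := InnerProductSpace.ofCore c.toCore
  exact inner_smul_right x y r

/-- The linear form `⟪x, ·⟫`. -/
def coreForm (c : InnerProductSpace.Core 𝕜 V) (x : V) : Module.Dual 𝕜 V where
  toFun y := c.inner x y
  map_add' := core_add_right c x
  map_smul' r y := core_smul_right c x y r

theorem exists_coreForm_eq [FiniteDimensional 𝕜 V] (c : InnerProductSpace.Core 𝕜 V)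
    (f : Module.Dual 𝕜 V) : ∃ x, coreForm c x = f := by
  letI := c.toNormedAddCommGroup
  letI := InnerProductSpace.ofCore c.toCore
  haveI : CompleteSpace V := FiniteDimensional.complete 𝕜 V
  refine ⟨(InnerProductSpace.toDual 𝕜 V).symm (LinearMap.toContinuousLinearMap f), ?_⟩
  ext y
  exact InnerProductSpace.toDual_symm_apply (𝕜 := 𝕜) (E := V)

theorem coreForm_injective (c : InnerProductSpace.Core 𝕜 V) :
    Function.Injective (coreForm c) := by
  letI := c.toNormedAddCommGroup
  letI := InnerProductSpace.ofCore c.toCore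
  intro x y h
  exact ext_inner_right 𝕜 fun v => LinearMap.congr_fun h v

/-- The vector representing a linear form: `f = ⟪riesz f, ·⟫`. -/
noncomputable def riesz [FiniteDimensional 𝕜 V] (c : InnerProductSpace.Core 𝕜 V)
    (f : Module.Dual 𝕜 V) : V := (exists_coreForm_eq c f).choose

theorem inner_riesz [FiniteDimensional 𝕜 V] (c : InnerProductSpace.Core 𝕜 V)
    (f : Module.Dual 𝕜 V) (y : V) : c.inner (riesz c f) y = f y :=
  LinearMap.congr_fun (exists_coreForm_eq c f).choose_spec y

theorem eq_riesz [FiniteDimensional 𝕜 V] (c : InnerProductSpace.Core 𝕜 V)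
    (f : Module.Dual 𝕜 V) (x : V) (h : ∀ y, c.inner x y = f y) : x = riesz c f :=
  coreForm_injective c (LinearMap.ext fun y => (h y).trans (inner_riesz c f y).symm)

theorem riesz_add [FiniteDimensional 𝕜 V] (c : InnerProductSpace.Core 𝕜 V)
    (f g : Module.Dual 𝕜 V) : riesz c (f + g) = riesz c f + riesz c g :=
  (eq_riesz c _ _ fun y => by
    rw [c.add_left, inner_riesz, inner_riesz, LinearMap.add_apply]).symm

theorem riesz_smul [FiniteDimensional 𝕜 V] (c : InnerProductSpace.Core 𝕜 V)
    (r : 𝕜) (f : Module.Dual 𝕜 V) : riesz c (r • f) = starRingEnd 𝕜 r • riesz c f :=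
  (eq_riesz c _ _ fun y => by
    rw [c.smul_left, inner_riesz, LinearMap.smul_apply, RCLike.conj_conj, smul_eq_mul]).symm

/-- The dual inner product, for which `f ↦ riesz f` is an antilinear isometry. -/
@[reducible] noncomputable def coreDual [FiniteDimensional 𝕜 V] (c : InnerProductSpace.Core 𝕜 V) :
    InnerProductSpace.Core 𝕜 (Module.Dual 𝕜 V) where
  inner f g := c.inner (riesz c g) (riesz c f)
  conj_inner_symm f g := c.conj_inner_symm _ _
  re_inner_nonneg f := c.re_inner_nonneg _
  add_left f g h := by rw [riesz_add, core_add_right]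
  smul_left f g r := by rw [riesz_smul, core_smul_right]
  definite f hf := by
    have h := c.definite _ hf
    ext y
    have h0 : riesz c (0 : Module.Dual 𝕜 V) = 0 := by
      simpa using riesz_smul c (0 : 𝕜) (0 : Module.Dual 𝕜 V)
    rw [← inner_riesz c f y, h, ← h0, inner_riesz]


theorem coreForm_add (c : InnerProductSpace.Core 𝕜 V) (a b : V) :
    coreForm c (a + b) = coreForm c a + coreForm c b :=
  LinearMap.ext fun z => c.add_left a b z

theorem coreForm_smul (c : InnerProductSpace.Core 𝕜 V) (r : 𝕜) (a : V) :
    coreForm c (r • a) = starRingEnd 𝕜 r • coreForm c a :=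
  LinearMap.ext fun z => c.smul_left a z r

theorem coreForm_update (c : InnerProductSpace.Core 𝕜 V) {n : ℕ} (y : Fin n → V)
    (hd : DecidableEq (Fin n)) (i : Fin n) (u : V) :
    (fun j => coreForm c (Function.update y i u j)) =
      Function.update (fun j => coreForm c (y j)) i (coreForm c u) := by
  ext1 j
  by_cases h : j = i
  · subst h; simp
  · simp [h]

/-- For fixed `x`, the alternating form `y ↦ conj ⟪y₁ ∧ ⋯ ∧ yₙ, x⟫`. -/
noncomputable def gramAlt (c : InnerProductSpace.Core 𝕜 V) (n : ℕ) (x : ⋀[𝕜]^n V) :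
    V [⋀^Fin n]→ₗ[𝕜] 𝕜 where
  toFun y := starRingEnd 𝕜 (exteriorPower.pairingDual 𝕜 V n
    (exteriorPower.ιMulti 𝕜 n fun i => coreForm c (y i)) x)
  map_update_add' y i a b := by
    rw [coreForm_update, coreForm_update, coreForm_update, coreForm_add,
      AlternatingMap.map_update_add, map_add, LinearMap.add_apply, map_add]
  map_update_smul' y i r a := by
    rw [coreForm_update, coreForm_update, coreForm_smul, AlternatingMap.map_update_smul, map_smul,
      LinearMap.smul_apply, smul_eq_mul, map_mul, RCLike.conj_conj, smul_eq_mul]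
  map_eq_zero_of_eq' y i j h hij := by
    rw [AlternatingMap.map_eq_zero_of_eq _ _ (i := i) (j := j) (by simp only [h]) hij, map_zero,
      LinearMap.zero_apply, map_zero]

/-- The Gram form on `⋀ⁿ V`. -/
noncomputable def gramForm (c : InnerProductSpace.Core 𝕜 V) (n : ℕ) (y x : ⋀[𝕜]^n V) : 𝕜 :=
  starRingEnd 𝕜 (exteriorPower.alternatingMapLinearEquiv (gramAlt c n x) y)

theorem gramForm_ιMulti (c : InnerProductSpace.Core 𝕜 V) (n : ℕ) (y x : Fin n → V) :
    gramForm c n (exteriorPower.ιMulti 𝕜 n y) (exteriorPower.ιMulti 𝕜 n x) =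
      Matrix.det (Matrix.of fun i j => c.inner (y i) (x j)) := by
  rw [gramForm, exteriorPower.alternatingMapLinearEquiv_apply_ιMulti]
  change starRingEnd 𝕜 (starRingEnd 𝕜 _) = _
  rw [RCLike.conj_conj, exteriorPower.pairingDual_ιMulti_ιMulti, ← Matrix.det_transpose]
  rfl

theorem gramForm_add_left (c : InnerProductSpace.Core 𝕜 V) (n : ℕ) (y y' x : ⋀[𝕜]^n V) :
    gramForm c n (y + y') x = gramForm c n y x + gramForm c n y' x := by
  simp [gramForm]

theorem gramForm_smul_left (c : InnerProductSpace.Core 𝕜 V) (n : ℕ) (y x : ⋀[𝕜]^n V) (r : 𝕜) :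
    gramForm c n (r • y) x = starRingEnd 𝕜 r * gramForm c n y x := by
  simp [gramForm]

theorem gramForm_add_right (c : InnerProductSpace.Core 𝕜 V) (n : ℕ) (y x x' : ⋀[𝕜]^n V) :
    gramForm c n y (x + x') = gramForm c n y x + gramForm c n y x' := by
  have h : gramAlt c n (x + x') = gramAlt c n x + gramAlt c n x' := by
    ext v
    simp [gramAlt]
  simp [gramForm, h]

theorem gramForm_smul_right (c : InnerProductSpace.Core 𝕜 V) (n : ℕ) (y x : ⋀[𝕜]^n V) (r : 𝕜) :
    gramForm c n y (r • x) = r * gramForm c n y x := by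
  have h : gramAlt c n (r • x) = starRingEnd 𝕜 r • gramAlt c n x := by
    ext v
    simp [gramAlt]
  simp [gramForm, h]

theorem ext_induction {R M : Type*} [CommRing R] [AddCommGroup M] [Module R M] {n : ℕ}
    {p : ⋀[R]^n M → Prop} (x : ⋀[R]^n M)
    (h0 : p 0) (hι : ∀ v, p (exteriorPower.ιMulti R n v)) (hadd : ∀ x y, p x → p y → p (x + y))
    (hsmul : ∀ (r : R) x, p x → p (r • x)) : p x := by
  have hx : x ∈ Submodule.span R (Set.range (exteriorPower.ιMulti R n (M := M))) := by
    rw [exteriorPower.ιMulti_span]; trivial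
  refine Submodule.span_induction (p := fun x _ => p x) ?_ h0 (fun x y _ _ => hadd x y)
    (fun r x _ => hsmul r x) hx
  rintro _ ⟨v, rfl⟩
  exact hι v

theorem gramForm_conj_symm (c : InnerProductSpace.Core 𝕜 V) (n : ℕ) (x y : ⋀[𝕜]^n V) :
    starRingEnd 𝕜 (gramForm c n y x) = gramForm c n x y := by
  have z1 : ∀ y, gramForm c n y 0 = 0 := fun y => by
    simpa using gramForm_smul_right c n y 0 0
  have z2 : ∀ y, gramForm c n 0 y = 0 := fun y => by
    simpa using gramForm_smul_left c n 0 y 0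
  refine ext_induction (p := fun x => starRingEnd 𝕜 (gramForm c n y x) = gramForm c n x y) x
    (by simp [z1, z2]) (fun v => ?_) (fun a b ha hb => ?_) (fun r a ha => ?_)
  · refine ext_induction (p := fun y => starRingEnd 𝕜 (gramForm c n y _) = gramForm c n _ y) y
      (by simp [z1, z2]) (fun w => ?_) (fun a b ha hb => ?_)
      (fun r a ha => ?_)
    · rw [gramForm_ιMulti, gramForm_ιMulti, RingHom.map_det, ← Matrix.det_transpose]
      congr 1
      ext i j
      exact c.conj_inner_symm _ _
    · rw [gramForm_add_left, gramForm_add_right, map_add, ha, hb]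
    · rw [gramForm_smul_left, gramForm_smul_right, map_mul, ha, RCLike.conj_conj]
  · rw [gramForm_add_left, gramForm_add_right, map_add, ha, hb]
  · rw [gramForm_smul_left, gramForm_smul_right, map_mul, ha]

theorem gramForm_self [FiniteDimensional 𝕜 V] (c : InnerProductSpace.Core 𝕜 V) (n : ℕ) :
    ∃ (ι : Type) (_ : Fintype ι) (B : Module.Basis ι 𝕜 (⋀[𝕜]^n V)),
      ∀ x, gramForm c n x x = ((∑ s, ‖B.repr x s‖ ^ 2 : ℝ) : 𝕜) := by
  classical
  letI := c.toNormedAddCommGroup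
  letI := InnerProductSpace.ofCore c.toCore
  let b := stdOrthonormalBasis 𝕜 V
  have hδ : ∀ s t, gramForm c n (b.toBasis.exteriorPower n s) (b.toBasis.exteriorPower n t) =
      if s = t then 1 else 0 := by
    intro s t
    have hb : ∀ i j, c.inner (b i) (b j) = if i = j then 1 else 0 :=
      orthonormal_iff_ite.mp b.orthonormal
    rw [exteriorPower.basis_apply, exteriorPower.basis_apply]
    simp only [exteriorPower.ιMulti_family, gramForm_ιMulti, OrthonormalBasis.coe_toBasis,
      Function.comp_apply, hb]
    split_ifs with h
    · subst h
      rw [← Matrix.det_one (n := Fin n)]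
      congr 1
      ext i j
      simp [Matrix.one_apply]
    · obtain ⟨x, hxt, hxs⟩ := (Set.powersetCard.exists_mem_notMem_iff_ne s t).mp h
      simp only [← Set.powersetCard.mem_range_ofFinEmbEquiv_symm_iff_mem, Set.mem_range,
        not_exists] at hxs hxt
      obtain ⟨i, rfl⟩ := hxt
      refine Matrix.det_eq_zero_of_row_eq_zero i fun j => ?_
      rw [Matrix.of_apply, if_neg fun h => hxs j h.symm]
  refine ⟨_, inferInstance, b.toBasis.exteriorPower n, fun x => ?_⟩
  have sum_left : ∀ (ι : Type) (S : Finset ι) (f : ι → ⋀[𝕜]^n V) y,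
      gramForm c n (∑ i ∈ S, f i) y = ∑ i ∈ S, gramForm c n (f i) y := fun ι S f y =>
    map_sum (AddMonoidHom.mk' (fun z => gramForm c n z y)
      fun a b => gramForm_add_left c n a b y) f S
  have sum_right : ∀ (ι : Type) (S : Finset ι) (f : ι → ⋀[𝕜]^n V) y,
      gramForm c n y (∑ i ∈ S, f i) = ∑ i ∈ S, gramForm c n y (f i) := fun ι S f y =>
    map_sum (AddMonoidHom.mk' (fun z => gramForm c n y z)
      fun a b => gramForm_add_right c n y a b) f S
  conv_lhs => rw [← (b.toBasis.exteriorPower n).sum_repr x]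
  simp only [sum_left, sum_right, gramForm_smul_left, gramForm_smul_right, hδ]
  simp [RCLike.mul_conj, mul_comm]

/-- The inner product on `⋀ⁿ V` with `⟪v₁ ∧ ⋯ ∧ vₙ, w₁ ∧ ⋯ ∧ wₙ⟫ = det (⟪vᵢ, wⱼ⟫)`. -/
@[reducible] noncomputable def coreExterior [FiniteDimensional 𝕜 V]
    (c : InnerProductSpace.Core 𝕜 V) (n : ℕ) : InnerProductSpace.Core 𝕜 (⋀[𝕜]^n V) where
  inner := gramForm c n
  conj_inner_symm := gramForm_conj_symm c n
  re_inner_nonneg x := by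
    obtain ⟨ι, _, B, hB⟩ := gramForm_self c n
    rw [hB, RCLike.ofReal_re]
    positivity
  add_left := gramForm_add_left c n
  smul_left := gramForm_smul_left c n
  definite x hx := by
    obtain ⟨ι, _, B, hB⟩ := gramForm_self c n
    change gramForm c n x x = 0 at hx
    rw [hB, RCLike.ofReal_eq_zero, Finset.sum_eq_zero_iff_of_nonneg fun _ _ => sq_nonneg _] at hx
    exact B.ext_elem fun s => by simpa using hx s

end InnerProducts

section BaseChange
variable (R A M : Type*) [CommRing R] [CommRing A] [Algebra R A] [AddCommGroup M] [Module R M]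

/-- The alternating map `(e₁, …, eₙ) ↦ (1 ⊗ e₁) ∧ ⋯ ∧ (1 ⊗ eₙ)`. -/
noncomputable def extAlt (n : ℕ) : M [⋀^Fin n]→ₗ[R] ⋀[A]^n (A ⊗[R] M) where
  toFun e := exteriorPower.ιMulti A n fun i => (1 : A) ⊗ₜ[R] e i
  map_update_add' e i a b := by
    have key : ∀ u : M, (fun j => (1 : A) ⊗ₜ[R] Function.update e i u j) =
        Function.update (fun j => (1 : A) ⊗ₜ[R] e j) i ((1 : A) ⊗ₜ u) := fun u => by
      ext1 j
      by_cases h : j = i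
      · subst h; simp
      · simp [h]
    rw [key, key, key, tmul_add, AlternatingMap.map_update_add]
  map_update_smul' e i r a := by
    have key : ∀ u : M, (fun j => (1 : A) ⊗ₜ[R] Function.update e i u j) =
        Function.update (fun j => (1 : A) ⊗ₜ[R] e j) i ((1 : A) ⊗ₜ u) := fun u => by
      ext1 j
      by_cases h : j = i
      · subst h; simp
      · simp [h]
    rw [key, key, tmul_smul, ← algebraMap_smul A r, AlternatingMap.map_update_smul,
      algebraMap_smul]
  map_eq_zero_of_eq' e i j h hij :=
    AlternatingMap.map_eq_zero_of_eq _ _ (i := i) (j := j) (by simp only [h]) hij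

/-- The canonical map `A ⊗ ⋀ⁿ M → ⋀ⁿ (A ⊗ M)`. -/
noncomputable def extBaseChange (n : ℕ) : A ⊗[R] ⋀[R]^n M →ₗ[A] ⋀[A]^n (A ⊗[R] M) :=
  AlgebraTensorModule.lift
    { toFun a := a • exteriorPower.alternatingMapLinearEquiv (extAlt R A M n)
      map_add' _ _ := add_smul _ _ _
      map_smul' _ _ := mul_smul _ _ _ }

variable {R A M}

theorem extBaseChange_tmul_ιMulti (n : ℕ) (a : A) (e : Fin n → M) :
    extBaseChange R A M n (a ⊗ₜ exteriorPower.ιMulti R n e) =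
      a • exteriorPower.ιMulti A n fun i => (1 : A) ⊗ₜ[R] e i := by
  change a • exteriorPower.alternatingMapLinearEquiv (extAlt R A M n) _ = _
  rw [exteriorPower.alternatingMapLinearEquiv_apply_ιMulti]
  rfl

theorem extBaseChange_naturality {N : Type*} [AddCommGroup N] [Module R N] (n : ℕ)
    (f : M →ₗ[R] N) (x : A ⊗[R] ⋀[R]^n M) :
    extBaseChange R A N n ((exteriorPower.map n f).baseChange A x) =
      exteriorPower.map n (f.baseChange A) (extBaseChange R A M n x) := by
  induction x with
  | zero => simp
  | add x y hx hy => simp only [map_add, hx, hy]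
  | tmul a w =>
    refine ext_induction (p := fun w => extBaseChange R A N n
      ((exteriorPower.map n f).baseChange A (a ⊗ₜ w)) =
        exteriorPower.map n (f.baseChange A) (extBaseChange R A M n (a ⊗ₜ w))) w (by simp) (fun v => ?_) (fun x y hx hy => ?_) (fun r x hx => ?_)
    · simp [extBaseChange_tmul_ιMulti, Function.comp_def]
    · simp only [tmul_add, map_add, hx, hy]
    · rw [tmul_smul, ← algebraMap_smul A r, map_smul, map_smul, map_smul, map_smul, hx]

theorem extBaseChange_injective_free (m n : ℕ) :
    Function.Injective (extBaseChange R A (Fin m → R) n) := by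
  rcases subsingleton_or_nontrivial A with _ | _
  · intro x y _
    exact (Module.subsingleton A _).elim x y
  let b := Pi.basisFun R (Fin m)
  let B := (b.exteriorPower n).baseChange A
  let B' := (b.baseChange A).exteriorPower n
  have h : extBaseChange R A (Fin m → R) n = (B.equiv B' (Equiv.refl _)).toLinearMap := by
    refine B.ext fun s => ?_
    rw [LinearEquiv.coe_coe, Module.Basis.equiv_apply, Module.Basis.baseChange_apply,
      exteriorPower.basis_apply, exteriorPower.basis_apply, exteriorPower.ιMulti_family,
      extBaseChange_tmul_ιMulti, one_smul, exteriorPower.ιMulti_family]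
    congr 1
    ext1 i
    simp [Module.Basis.baseChange_apply]
  rw [h]
  exact (B.equiv B' _).injective

theorem exists_split (R M : Type*) [CommRing R] [AddCommGroup M] [Module R M] [Module.Finite R M]
    [Module.Projective R M] :
    ∃ (m : ℕ) (s : M →ₗ[R] (Fin m → R)) (p : (Fin m → R) →ₗ[R] M), p ∘ₗ s = LinearMap.id := by
  obtain ⟨m, p, hp⟩ := Module.Finite.exists_fin' R M
  obtain ⟨s, hs⟩ := Module.projective_lifting_property p LinearMap.id hp
  exact ⟨m, s, p, hs⟩

theorem extBaseChange_injective [Module.Finite R M] [Module.Projective R M] (n : ℕ) :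
    Function.Injective (extBaseChange R A M n) := by
  obtain ⟨m, s, p, hps⟩ := exists_split R M
  have h1 : Function.Injective ((exteriorPower.map n s).baseChange A) := by
    refine Function.LeftInverse.injective (g := (exteriorPower.map n p).baseChange A) fun x => ?_
    rw [← LinearMap.comp_apply, ← LinearMap.baseChange_comp, ← exteriorPower.map_comp, hps,
      exteriorPower.map_id, LinearMap.baseChange_id, LinearMap.id_apply]
  intro x y hxy
  apply h1
  apply extBaseChange_injective_free (R := R) (A := A) m n
  rw [extBaseChange_naturality, extBaseChange_naturality, hxy]

variable (R A M) in
/-- The canonical map `A ⊗ Hom (M, R) → Hom (A ⊗ M, A)`. -/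
noncomputable def dualBaseChange :
    A ⊗[R] Module.Dual R M →ₗ[A] Module.Dual A (A ⊗[R] M) :=
  AlgebraTensorModule.lift
    { toFun a := a • Module.Dual.baseChange (R := R) (V := M) A
      map_add' _ _ := add_smul _ _ _
      map_smul' _ _ := mul_smul _ _ _ }

theorem dualBaseChange_tmul (a : A) (f : Module.Dual R M) (b : A) (v : M) :
    dualBaseChange R A M (a ⊗ₜ f) (b ⊗ₜ v) = a * (f v • b) := rfl

theorem dualBaseChange_injective [Module.Flat R A] [Module.Finite R M] [Module.Projective R M] :
    Function.Injective (dualBaseChange R A M) := by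
  have : Module.FinitePresentation R M := Module.finitePresentation_of_projective R M
  have hb := Module.FinitePresentation.isBaseChange_map R M R A
  have h : dualBaseChange R A M = ((AlgebraTensorModule.rid R A A).toLinearMap.compRight A) ∘ₗ
      hb.equiv.toLinearMap := by
    ext f v
    simp [dualBaseChange_tmul, IsBaseChange.equiv_tmul]
  rw [h]
  refine Function.Injective.comp (g := LinearMap.compRight A _) (fun f g hfg => ?_)
    hb.equiv.injective
  ext v
  have := LinearMap.congr_fun hfg (1 ⊗ₜ v)
  exact (AlgebraTensorModule.rid R A A).injective this

end BaseChange

section Metrics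

variable {K : Type*} [Field K]

/-- The field `ℂ` as an algebra over `𝓞 K` through the embedding `σ`. -/
@[reducible] noncomputable def embAlgebra (σ : K →+* ℂ) : Algebra (𝓞 K) ℂ :=
  (σ.comp (algebraMap (𝓞 K) K)).toAlgebra

/-- The complex vector space `E_σ = ℂ ⊗_σ E`. -/
def Fiber (σ : K →+* ℂ) (E : Type*) [AddCommGroup E] [Module (𝓞 K) E] : Type _ :=
  letI := embAlgebra σ
  ℂ ⊗[𝓞 K] E

section Fiber

variable (σ : K →+* ℂ) {E : Type*} [AddCommGroup E] [Module (𝓞 K) E]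

noncomputable instance : AddCommGroup (Fiber σ E) :=
  letI := embAlgebra σ
  (TensorProduct.addCommGroup : AddCommGroup (ℂ ⊗[𝓞 K] E))

noncomputable instance : Module ℂ (Fiber σ E) :=
  letI := embAlgebra σ
  (TensorProduct.leftModule : Module ℂ (ℂ ⊗[𝓞 K] E))

instance [Module.Finite (𝓞 K) E] : FiniteDimensional ℂ (Fiber σ E) :=
  letI := embAlgebra σ
  (Module.Finite.base_change (𝓞 K) ℂ E : Module.Finite ℂ (ℂ ⊗[𝓞 K] E))

/-- The image `1 ⊗ e` of `e` in `E_σ`. -/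
noncomputable def toFiber (e : E) : Fiber σ E :=
  letI := embAlgebra σ
  (1 : ℂ) ⊗ₜ[𝓞 K] e

theorem toFiber_add (e f : E) : toFiber σ (e + f) = toFiber σ e + toFiber σ f :=
  letI := embAlgebra σ
  tmul_add (1 : ℂ) e f

theorem toFiber_smul (a : 𝓞 K) (e : E) : toFiber σ (a • e) = σ a • toFiber σ e := by
  letI := embAlgebra σ
  change (1 : ℂ) ⊗ₜ[𝓞 K] (a • e) = σ a • ((1 : ℂ) ⊗ₜ[𝓞 K] e)
  rw [tmul_smul, ← algebraMap_smul ℂ a]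
  rfl

theorem toFiber_zero : toFiber σ (0 : E) = 0 :=
  letI := embAlgebra σ
  tmul_zero E (1 : ℂ)

theorem fiber_induction {S : Set E} (hS : Submodule.span (𝓞 K) S = ⊤) {p : Fiber σ E → Prop}
    (x : Fiber σ E) (h0 : p 0) (h1 : ∀ s ∈ S, p (toFiber σ s)) (hadd : ∀ x y, p x → p y → p (x + y))
    (hsmul : ∀ (z : ℂ) x, p x → p (z • x)) : p x := by
  letI := embAlgebra σ
  refine TensorProduct.induction_on (motive := p) x h0 (fun a e => ?_) hadd
  have he : e ∈ Submodule.span (𝓞 K) S := hS ▸ Submodule.mem_top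
  have h2 : p (toFiber σ e) := by
    refine Submodule.span_induction (p := fun e _ => p (toFiber σ e)) h1
      (by rw [toFiber_zero]; exact h0)
      (fun a b _ _ ha hb => by rw [toFiber_add]; exact hadd _ _ ha hb)
      (fun r e _ h => by rw [toFiber_smul]; exact hsmul _ _ h) he
  have h3 : a ⊗ₜ[𝓞 K] e = a • ((1 : ℂ) ⊗ₜ[𝓞 K] e) := by
    rw [smul_tmul', smul_eq_mul, mul_one]
  rw [h3]
  exact hsmul a _ h2

variable (E) in
/-- Complex conjugation `E_σ → E_σ̄`, `z ⊗ e ↦ z̄ ⊗ e`. -/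
noncomputable def conjFiber :
    Fiber σ E →ₛₗ[starRingEnd ℂ] Fiber (ComplexEmbedding.conjugate σ) E :=
  let f : Fiber σ E →+ Fiber (ComplexEmbedding.conjugate σ) E :=
    letI := embAlgebra σ
    TensorProduct.liftAddHom
      (AddMonoidHom.mk' (fun z : ℂ => AddMonoidHom.mk'
        (fun e : E => starRingEnd ℂ z • toFiber (ComplexEmbedding.conjugate σ) e)
        fun e f => by rw [toFiber_add, smul_add])
        fun z w => AddMonoidHom.ext fun e => by
          change starRingEnd ℂ (z + w) • toFiber (ComplexEmbedding.conjugate σ) e = _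
          rw [map_add, add_smul]
          rfl)
      fun a z e => by
        change starRingEnd ℂ (σ a * z) • toFiber (ComplexEmbedding.conjugate σ) e =
          starRingEnd ℂ z • toFiber (ComplexEmbedding.conjugate σ) (a • e)
        rw [toFiber_smul, smul_smul, map_mul, mul_comm]
        rfl
  { f with
    map_smul' := fun w x => by
      letI := embAlgebra σ
      change f (w • x) = starRingEnd ℂ w • f x
      refine TensorProduct.induction_on
        (motive := fun x : Fiber σ E => f (w • x) = starRingEnd ℂ w • f x) x ?_ (fun z e => ?_)
        fun (x y : Fiber σ E) hx hy => ?_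
      · change f (w • (0 : Fiber σ E)) = _ • f 0
        simp
      · change starRingEnd ℂ (w * z) • toFiber _ e = starRingEnd ℂ w • starRingEnd ℂ z • toFiber _ e
        rw [map_mul, mul_smul]
      · change f (w • (x + y)) = starRingEnd ℂ w • f (x + y)
        rw [smul_add, map_add, map_add, smul_add, hx, hy] }

theorem conjFiber_toFiber (e : E) :
    conjFiber σ E (toFiber σ e) = toFiber (ComplexEmbedding.conjugate σ) e := by
  change starRingEnd ℂ 1 • toFiber _ e = _
  rw [map_one, one_smul]

theorem conjFiber_surjective : Function.Surjective (conjFiber σ E) := fun x => by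
  refine fiber_induction _ Submodule.span_univ (p := fun x => ∃ y, conjFiber σ E y = x) x
    ⟨0, map_zero _⟩ (fun e _ => ⟨toFiber σ e, conjFiber_toFiber σ e⟩) ?_ ?_
  · rintro _ _ ⟨x, rfl⟩ ⟨y, rfl⟩
    exact ⟨x + y, map_add _ _ _⟩
  · rintro z _ ⟨x, rfl⟩
    exact ⟨starRingEnd ℂ z • x, by rw [map_smulₛₗ, Complex.conj_conj]⟩

/-- Compatibility with complex conjugation may be checked on generators. -/
theorem conj_invariant_of_span {S : Set E} (hS : Submodule.span (𝓞 K) S = ⊤)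
    (c : InnerProductSpace.Core ℂ (Fiber σ E))
    (d : InnerProductSpace.Core ℂ (Fiber (ComplexEmbedding.conjugate σ) E))
    (h : ∀ s ∈ S, ∀ t ∈ S, d.inner (toFiber _ s) (toFiber _ t) =
      starRingEnd ℂ (c.inner (toFiber σ s) (toFiber σ t))) (x y : Fiber σ E) :
    d.inner (conjFiber σ E x) (conjFiber σ E y) = starRingEnd ℂ (c.inner x y) := by
  have c0 : ∀ z, c.inner z 0 = 0 := fun z => by simpa using core_smul_right c z 0 0
  have d0 : ∀ z, d.inner z 0 = 0 := fun z => by simpa using core_smul_right d z 0 0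
  have c0' : ∀ z, c.inner 0 z = 0 := fun z => by simpa using c.smul_left 0 z 0
  have d0' : ∀ z, d.inner 0 z = 0 := fun z => by simpa using d.smul_left 0 z 0
  refine fiber_induction σ hS (p := fun x =>
    d.inner (conjFiber σ E x) (conjFiber σ E y) = starRingEnd ℂ (c.inner x y)) x
    (by simp only [map_zero, c0', d0']) (fun s hs => ?_) (fun a b ha hb => ?_) (fun z a ha => ?_)
  · refine fiber_induction σ hS (p := fun y =>
      d.inner (conjFiber σ E (toFiber σ s)) (conjFiber σ E y) =
        starRingEnd ℂ (c.inner (toFiber σ s) y)) y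
      (by simp only [map_zero, c0, d0]) (fun t ht => ?_) (fun a b ha hb => ?_) (fun z a ha => ?_)
    · rw [conjFiber_toFiber, conjFiber_toFiber, h s hs t ht]
    · rw [map_add, core_add_right, core_add_right, map_add, ha, hb]
    · rw [map_smulₛₗ, core_smul_right, core_smul_right, map_mul, ha]
  · rw [map_add, d.add_left, c.add_left, map_add, ha, hb]
  · rw [map_smulₛₗ, d.smul_left, c.smul_left, map_mul, ha]

end Fiber

variable (K) in
/-- A hermitian structure on the `𝓞 K`-module `E`: hermitian inner products on the complex vector
spaces `E_σ`, invariant under complex conjugation. A hermitian vector bundle over `Spec (𝓞 K)` is a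
finitely generated projective `𝓞 K`-module together with such a structure. -/
structure HermitianMetric (E : Type*) [AddCommGroup E] [Module (𝓞 K) E] where
  /-- The hermitian inner product on `E_σ`. -/
  core : ∀ σ : K →+* ℂ, InnerProductSpace.Core ℂ (Fiber σ E)
  conj_invariant : ∀ (σ : K →+* ℂ) (x y : Fiber σ E),
    (core (ComplexEmbedding.conjugate σ)).inner (conjFiber σ E x) (conjFiber σ E y) =
      starRingEnd ℂ ((core σ).inner x y)

theorem flat_complex [NumberField K] (σ : K →+* ℂ) :
    letI := embAlgebra σ
    Module.Flat (𝓞 K) ℂ := by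
  letI := embAlgebra σ
  have : FaithfulSMul (𝓞 K) ℂ := (faithfulSMul_iff_algebraMap_injective _ _).mpr
    (σ.injective.comp (FaithfulSMul.algebraMap_injective (𝓞 K) K))
  infer_instance

/-- A finitely generated torsion-free `𝓞 K`-module is projective. -/
instance projective_submodule [NumberField K] {E : Type*} [AddCommGroup E] [Module (𝓞 K) E]
    [Module.Finite (𝓞 K) E] [Module.Projective (𝓞 K) E] (N : Submodule (𝓞 K) E) :
    Module.Projective (𝓞 K) N :=
  have : Module.FinitePresentation (𝓞 K) N := Module.finitePresentation_of_finite (𝓞 K) N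
  Module.Flat.projective_of_finitePresentation

namespace HermitianMetric

variable {E F : Type*} [AddCommGroup E] [Module (𝓞 K) E] [AddCommGroup F] [Module (𝓞 K) F]

/-- The norm `‖e‖_σ` of (the image in `E_σ` of) an element `e` of `E`. -/
noncomputable def norm (h : HermitianMetric K E) (σ : K →+* ℂ) (e : E) : ℝ :=
  √((h.core σ).inner (toFiber σ e) (toFiber σ e)).re

theorem conj_invariant_toFiber (h : HermitianMetric K E) (σ : K →+* ℂ) (x y : E) :
    (h.core (ComplexEmbedding.conjugate σ)).inner (toFiber _ x) (toFiber _ y) =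
      starRingEnd ℂ ((h.core σ).inner (toFiber σ x) (toFiber σ y)) := by
  rw [← h.conj_invariant, conjFiber_toFiber, conjFiber_toFiber]

/-- The hermitian structure on `E ⊗ F`. -/
noncomputable def tensor (h : HermitianMetric K E) (k : HermitianMetric K F) :
    HermitianMetric K (E ⊗[𝓞 K] F) where
  core σ :=
    letI := embAlgebra σ
    coreComap (V := ℂ ⊗[𝓞 K] (E ⊗[𝓞 K] F)) (W := (ℂ ⊗[𝓞 K] E) ⊗[ℂ] (ℂ ⊗[𝓞 K] F))
      (coreTensor (h.core σ) (k.core σ))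
      (AlgebraTensorModule.distribBaseChange (𝓞 K) ℂ E F).toLinearMap
      (LinearEquiv.injective _)
  conj_invariant σ := by
    refine conj_invariant_of_span σ (TensorProduct.span_tmul_eq_top (𝓞 K) E F) _ _ ?_
    rintro _ ⟨e, f, rfl⟩ _ ⟨e', f', rfl⟩
    change (h.core _).inner (toFiber _ e) (toFiber _ e') *
      (k.core _).inner (toFiber _ f) (toFiber _ f') =
      starRingEnd ℂ ((h.core _).inner (toFiber _ e) (toFiber _ e') *
        (k.core _).inner (toFiber _ f) (toFiber _ f'))
    rw [map_mul, conj_invariant_toFiber, conj_invariant_toFiber]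

/-- The extension to `E_σ` of a linear form on `E`. -/
noncomputable def dualFiber (σ : K →+* ℂ) :
    Fiber σ (Module.Dual (𝓞 K) E) →ₗ[ℂ] Module.Dual ℂ (Fiber σ E) :=
  letI := embAlgebra σ
  dualBaseChange (𝓞 K) ℂ E

theorem dualFiber_toFiber (σ : K →+* ℂ) (f : Module.Dual (𝓞 K) E) (e : E) :
    dualFiber σ (toFiber σ f) (toFiber σ e) = σ (f e) := by
  change (1 : ℂ) * (σ (f e) * 1) = σ (f e)
  rw [one_mul, mul_one]

theorem dualFiber_injective [NumberField K] [Module.Finite (𝓞 K) E] [Module.Projective (𝓞 K) E]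
    (σ : K →+* ℂ) : Function.Injective (dualFiber (E := E) σ) :=
  letI := embAlgebra σ
  haveI := flat_complex σ
  dualBaseChange_injective (R := 𝓞 K) (A := ℂ) (M := E)

/-- The dual hermitian structure on `Hom (E, 𝓞 K)`. -/
noncomputable def dual [NumberField K] [Module.Finite (𝓞 K) E] [Module.Projective (𝓞 K) E]
    (h : HermitianMetric K E) : HermitianMetric K (Module.Dual (𝓞 K) E) where
  core σ := coreComap (coreDual (h.core σ)) (dualFiber σ) (dualFiber_injective σ)
  conj_invariant σ := by
    refine conj_invariant_of_span σ Submodule.span_univ _ _ fun f _ g _ => ?_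
    have key : ∀ f : Module.Dual (𝓞 K) E,
        riesz (h.core (ComplexEmbedding.conjugate σ)) (dualFiber _ (toFiber _ f)) =
          conjFiber σ E (riesz (h.core σ) (dualFiber σ (toFiber σ f))) := fun f => by
      refine (eq_riesz _ _ _ fun y => ?_).symm
      obtain ⟨y, rfl⟩ := conjFiber_surjective σ y
      rw [h.conj_invariant, inner_riesz]
      refine fiber_induction σ Submodule.span_univ (p := fun y => starRingEnd ℂ
        (dualFiber σ (toFiber σ f) y) = dualFiber _ (toFiber _ f) (conjFiber σ E y)) y
        (by simp only [map_zero]) (fun e _ => ?_) (fun x y hx hy => ?_) fun z x hx => ?_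
      · rw [conjFiber_toFiber, dualFiber_toFiber, dualFiber_toFiber]
        rfl
      · simp only [map_add, hx, hy]
      · rw [map_smul (dualFiber σ (toFiber σ f)), LinearMap.map_smulₛₗ (conjFiber σ E),
          map_smul (dualFiber _ (toFiber _ f)), smul_eq_mul, map_mul, hx, smul_eq_mul]
    change (h.core _).inner (riesz _ _) (riesz _ _) =
      starRingEnd ℂ ((h.core _).inner (riesz _ _) (riesz _ _))
    rw [key, key, h.conj_invariant]

/-- The hermitian structure induced on a submodule. -/
noncomputable def restrict [NumberField K] (h : HermitianMetric K E) (N : Submodule (𝓞 K) E) :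
    HermitianMetric K ↥N where
  core σ :=
    letI := embAlgebra σ
    haveI := flat_complex σ
    coreComap (V := ℂ ⊗[𝓞 K] N) (W := ℂ ⊗[𝓞 K] E) (h.core σ) (N.subtype.baseChange ℂ)
      (Module.Flat.lTensor_preserves_injective_linearMap _ N.injective_subtype)
  conj_invariant σ := by
    refine conj_invariant_of_span σ Submodule.span_univ _ _ fun x _ y _ => ?_
    exact h.conj_invariant_toFiber σ x y

/-- The hermitian structure on `⋀ⁿ E`. -/
noncomputable def exterior [Module.Finite (𝓞 K) E] [Module.Projective (𝓞 K) E]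
    (h : HermitianMetric K E) (n : ℕ) : HermitianMetric K ↥(⋀[𝓞 K]^n E) where
  core σ :=
    letI := embAlgebra σ
    coreComap (V := ℂ ⊗[𝓞 K] ⋀[𝓞 K]^n E) (W := ⋀[ℂ]^n (ℂ ⊗[𝓞 K] E))
      (coreExterior (V := ℂ ⊗[𝓞 K] E) (h.core σ) n) (extBaseChange (𝓞 K) ℂ E n)
      (extBaseChange_injective n)
  conj_invariant σ := by
    refine conj_invariant_of_span σ (exteriorPower.ιMulti_span (𝓞 K) n E) _ _ ?_
    have key : ∀ (τ : K →+* ℂ) (v w : Fin n → E),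
        letI := embAlgebra τ
        gramForm (V := ℂ ⊗[𝓞 K] E) (h.core τ) n
          (extBaseChange (𝓞 K) ℂ E n ((1 : ℂ) ⊗ₜ exteriorPower.ιMulti (𝓞 K) n v))
          (extBaseChange (𝓞 K) ℂ E n ((1 : ℂ) ⊗ₜ exteriorPower.ιMulti (𝓞 K) n w)) =
        Matrix.det (Matrix.of fun i j => (h.core τ).inner (toFiber τ (v i)) (toFiber τ (w j))) :=
      fun τ v w => by
        letI := embAlgebra τ
        rw [extBaseChange_tmul_ιMulti, extBaseChange_tmul_ιMulti, one_smul, one_smul]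
        exact gramForm_ιMulti (V := ℂ ⊗[𝓞 K] E) (h.core τ) n _ _
    rintro _ ⟨v, rfl⟩ _ ⟨w, rfl⟩
    refine (key _ v w).trans (Eq.trans ?_ (congrArg (starRingEnd ℂ) (key σ v w).symm))
    rw [RingHom.map_det]
    congr 1
    ext i j
    exact h.conj_invariant_toFiber σ (v i) (w j)

section Degrees

variable [NumberField K]

open Classical in
/-- The arithmetic degree of a hermitian line bundle `L`:
`log #(L / 𝓞 K · s) - ∑ σ, log ‖s‖_σ`, for any non-zero `s` in `L`; the choice of `s` does not
matter, see `lineDegree_eq`. -/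
noncomputable def lineDegree (h : HermitianMetric K E) : ℝ :=
  if hs : ∃ s : E, s ≠ 0 then
    Real.log (Nat.card (E ⧸ Submodule.span (𝓞 K) {hs.choose})) -
      ∑ σ : K →+* ℂ, Real.log (h.norm σ hs.choose)
  else 0

theorem norm_smul (h : HermitianMetric K E) (σ : K →+* ℂ) (a : 𝓞 K) (e : E) :
    h.norm σ (a • e) = ‖σ a‖ * h.norm σ e := by
  have h1 : (h.core σ).inner (toFiber σ (a • e)) (toFiber σ (a • e)) =
      ((‖σ a‖ ^ 2 : ℝ) : ℂ) * (h.core σ).inner (toFiber σ e) (toFiber σ e) := by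
    rw [toFiber_smul, (h.core σ).smul_left, core_smul_right, ← mul_assoc, Complex.conj_mul']
    push_cast
    rfl
  rw [norm, h1, Complex.re_ofReal_mul, Real.sqrt_mul (by positivity), Real.sqrt_sq (by positivity),
    norm]

theorem norm_ne_zero [Module.IsTorsionFree (𝓞 K) E] (h : HermitianMetric K E) (σ : K →+* ℂ)
    {e : E} (he : e ≠ 0) : h.norm σ e ≠ 0 := by
  have h0 : toFiber σ e ≠ 0 := by
    letI := embAlgebra σ
    have hinj : Function.Injective (algebraMap (𝓞 K) ℂ) :=
      σ.injective.comp (FaithfulSMul.algebraMap_injective (𝓞 K) K)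
    intro h0
    apply he
    have h1 : Function.Injective (LinearMap.rTensor E (Algebra.linearMap (𝓞 K) ℂ)) :=
      Module.Flat.rTensor_preserves_injective_linearMap _ hinj
    have h2 : LinearMap.rTensor E (Algebra.linearMap (𝓞 K) ℂ) ((1 : 𝓞 K) ⊗ₜ e) = 0 := by
      rw [LinearMap.rTensor_tmul, Algebra.linearMap_apply, map_one]
      exact h0
    have h3 := h1 (h2.trans (map_zero _).symm)
    simpa using congrArg (TensorProduct.lid (𝓞 K) E) h3
  intro h1
  have h2 : 0 ≤ ((h.core σ).inner (toFiber σ e) (toFiber σ e)).re := (h.core σ).re_inner_nonneg _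
  rw [norm, Real.sqrt_eq_zero h2] at h1
  refine h0 ((h.core σ).definite _ (Complex.ext h1 ?_))
  have := congrArg Complex.im ((h.core σ).conj_inner_symm (toFiber σ e) (toFiber σ e))
  rw [Complex.conj_im] at this
  rw [Complex.zero_im]
  linarith

theorem sum_log_embeddings (a : 𝓞 K) (ha : a ≠ 0) :
    ∑ σ : K →+* ℂ, Real.log ‖σ a‖ = Real.log (Ideal.absNorm (Ideal.span {a})) := by
  rw [← Real.log_prod fun σ _ => by simpa using ha, Ideal.absNorm_span_singleton]
  congr 1
  have h1 := Algebra.norm_eq_prod_embeddings ℚ ℂ (a : K)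
  have h2 : ∏ σ : K →+* ℂ, ‖σ a‖ = ‖algebraMap ℚ ℂ (Algebra.norm ℚ (a : K))‖ := by
    rw [h1, norm_prod]
    exact Fintype.prod_equiv (RingHom.equivRatAlgHom K ℂ) _ _ fun _ => rfl
  rw [h2, ← Algebra.coe_norm_int]
  simp [Nat.cast_natAbs]

theorem exists_smul_eq_smul (hE : Module.finrank (𝓞 K) E = 1) {s : E} (x : E) (hs : s ≠ 0)
    [Module.IsTorsionFree (𝓞 K) E] [Module.Finite (𝓞 K) E] :
    ∃ a b : 𝓞 K, a ≠ 0 ∧ a • x = b • s := by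
  by_contra! hc
  have hli : LinearIndependent (𝓞 K) ![x, s] := by
    rw [LinearIndependent.pair_iff]
    intro a b hab
    have ha : a = 0 := by
      by_contra ha
      exact hc a (-b) ha (by rw [neg_smul]; exact eq_neg_of_add_eq_zero_left hab)
    refine ⟨ha, ?_⟩
    rw [ha, zero_smul, zero_add] at hab
    exact (smul_eq_zero.mp hab).resolve_right hs
  have := hli.fintype_card_le_finrank
  rw [hE, Fintype.card_fin] at this
  omega

theorem finite_quotient (hE : Module.finrank (𝓞 K) E = 1) {s : E} (hs : s ≠ 0)
    [Module.IsTorsionFree (𝓞 K) E] [Module.Finite (𝓞 K) E] :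
    Finite (E ⧸ Submodule.span (𝓞 K) {s}) := by
  have : Module.Finite ℤ (E ⧸ Submodule.span (𝓞 K) {s}) := Module.Finite.trans (𝓞 K) _
  refine Module.finite_of_fg_torsion _ fun x => ?_
  obtain ⟨x, rfl⟩ := Submodule.Quotient.mk_surjective _ x
  obtain ⟨a, b, ha, hab⟩ := exists_smul_eq_smul hE x hs
  obtain ⟨c, hc⟩ := Ideal.mem_span_singleton.mp (Ideal.absNorm_mem (Ideal.span {a}))
  have h0 : Ideal.absNorm (Ideal.span {a}) ≠ 0 := by
    simpa [Ideal.absNorm_eq_zero_iff] using ha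
  refine ⟨⟨(Ideal.absNorm (Ideal.span {a}) : ℤ),
    mem_nonZeroDivisors_of_ne_zero (by exact_mod_cast h0)⟩, ?_⟩
  change ((Ideal.absNorm (Ideal.span {a}) : ℕ) : ℤ) •
    (Submodule.Quotient.mk x : E ⧸ Submodule.span (𝓞 K) {s}) = 0
  rw [← Submodule.Quotient.mk_smul, Submodule.Quotient.mk_eq_zero,
    Submodule.mem_span_singleton]
  refine ⟨c * b, ?_⟩
  rw [mul_smul, ← hab, smul_smul, mul_comm c a, ← hc, natCast_zsmul, Nat.cast_smul_eq_nsmul (𝓞 K)]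

theorem card_quotient_smul (s : E) (hs : s ≠ 0) [Module.IsTorsionFree (𝓞 K) E] (a : 𝓞 K) :
    Nat.card (E ⧸ Submodule.span (𝓞 K) {a • s}) =
      Ideal.absNorm (Ideal.span {a}) * Nat.card (E ⧸ Submodule.span (𝓞 K) {s}) := by
  let f := LinearMap.toSpanSingleton (𝓞 K) E s
  have hf : Function.Injective f := smul_left_injective (𝓞 K) hs
  have h1 : Submodule.span (𝓞 K) {s} = (⊤ : Submodule (𝓞 K) (𝓞 K)).map f := by
    rw [Submodule.map_top, LinearMap.range_toSpanSingleton]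
  have h2 : Submodule.span (𝓞 K) {a • s} = Submodule.map f (Submodule.span (𝓞 K) {a}) := by
    rw [Submodule.map_span, Set.image_singleton]
    rfl
  have h3 := AddSubgroup.relIndex_mul_index (G := E)
    (H := (Submodule.span (𝓞 K) {a • s}).toAddSubgroup)
    (K := (Submodule.span (𝓞 K) {s}).toAddSubgroup) (by
      change Submodule.span (𝓞 K) {a • s} ≤ Submodule.span (𝓞 K) {s}
      rw [Submodule.span_singleton_le_iff_mem]
      exact Submodule.smul_mem _ _ (Submodule.mem_span_singleton_self s))
  have h4 : (Submodule.span (𝓞 K) {a • s}).toAddSubgroup.relIndex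
      (Submodule.span (𝓞 K) {s}).toAddSubgroup = Ideal.absNorm (Ideal.span {a}) := by
    rw [h1, h2, Submodule.map_toAddSubgroup, Submodule.map_toAddSubgroup,
      AddSubgroup.relIndex_map_map_of_injective _ _ hf, Submodule.top_toAddSubgroup,
      AddSubgroup.relIndex_top_right]
    rfl
  rw [h4] at h3
  exact h3.symm

/-- The arithmetic degree of a line bundle does not depend on the non-zero section. -/
theorem lineDegree_eq [Module.IsTorsionFree (𝓞 K) E] [Module.Finite (𝓞 K) E]
    (h : HermitianMetric K E) (hE : Module.finrank (𝓞 K) E = 1) {s : E} (hs : s ≠ 0) :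
    h.lineDegree = Real.log (Nat.card (E ⧸ Submodule.span (𝓞 K) {s})) -
      ∑ σ : K →+* ℂ, Real.log (h.norm σ s) := by
  have key : ∀ (t : E) (a : 𝓞 K), t ≠ 0 → a ≠ 0 →
      Real.log (Nat.card (E ⧸ Submodule.span (𝓞 K) {a • t})) -
        ∑ σ : K →+* ℂ, Real.log (h.norm σ (a • t)) =
      Real.log (Nat.card (E ⧸ Submodule.span (𝓞 K) {t})) -
        ∑ σ : K →+* ℂ, Real.log (h.norm σ t) := by
    intro t a ht ha
    have := finite_quotient hE ht
    have h1 : (Nat.card (E ⧸ Submodule.span (𝓞 K) {t}) : ℝ) ≠ 0 :=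
      Nat.cast_ne_zero.mpr Nat.card_pos.ne'
    have h2 : (Ideal.absNorm (Ideal.span {a}) : ℝ) ≠ 0 := by
      simpa [Ideal.absNorm_eq_zero_iff] using ha
    have h3 : ∀ σ : K →+* ℂ, Real.log (h.norm σ (a • t)) =
        Real.log ‖σ a‖ + Real.log (h.norm σ t) := fun σ => by
      rw [norm_smul, Real.log_mul (by simpa using ha) (h.norm_ne_zero σ ht)]
    rw [card_quotient_smul t ht, Nat.cast_mul, Real.log_mul h2 h1, Finset.sum_congr rfl fun σ _ =>
      h3 σ, Finset.sum_add_distrib, sum_log_embeddings a ha]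
    ring
  have hex : ∃ s : E, s ≠ 0 := ⟨s, hs⟩
  rw [lineDegree, dif_pos hex]
  obtain ⟨a, b, ha, hab⟩ := exists_smul_eq_smul hE hex.choose hs
  have hb : b ≠ 0 := by
    rintro rfl
    rw [zero_smul] at hab
    exact (smul_eq_zero.mp hab).elim ha hex.choose_spec
  rw [← key _ a hex.choose_spec ha, hab, key s b hs hb]

variable [Module.Finite (𝓞 K) E] [Module.Projective (𝓞 K) E]

/-- The arithmetic degree of a hermitian vector bundle, that is, of its determinant line bundle. -/
noncomputable def degree (h : HermitianMetric K E) : ℝ :=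
  (h.exterior (Module.finrank (𝓞 K) E)).lineDegree

/-- The normalized arithmetic degree. -/
noncomputable def normalizedDegree (h : HermitianMetric K E) : ℝ :=
  h.degree / Module.finrank ℚ K

/-- The normalized arithmetic slope. -/
noncomputable def slope (h : HermitianMetric K E) : ℝ :=
  h.normalizedDegree / Module.finrank (𝓞 K) E

/-- The slopes of the subbundles of positive rank, with the induced hermitian structures; every
submodule of `E` is finitely generated and projective. -/
def subbundleSlopes (h : HermitianMetric K E) : Set ℝ :=
  {x | ∃ N : Submodule (𝓞 K) E, 0 < Module.finrank (𝓞 K) N ∧ x = (h.restrict N).slope}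

/-- The normalized degrees of the sub-line bundles, with the induced hermitian structures. -/
def subLineDegrees (h : HermitianMetric K E) : Set ℝ :=
  {x | ∃ N : Submodule (𝓞 K) E,
    Module.finrank (𝓞 K) N = 1 ∧ x = (h.restrict N).normalizedDegree}

/-- The maximal slope. -/
noncomputable def maxSlope (h : HermitianMetric K E) : ℝ := sSup h.subbundleSlopes

/-- The minimal slope. -/
noncomputable def minSlope (h : HermitianMetric K E) : ℝ := -h.dual.maxSlope

/-- The normalized upper arithmetic degree. -/
noncomputable def upperDegree (h : HermitianMetric K E) : ℝ := sSup h.subLineDegrees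

end Degrees

end HermitianMetric
end Metrics

end Arakelov

/-! Let `L` be a rank-one submodule of `F ⊗ G`. After scaling, a nonzero `s` in `L` is `∑ aᵢ ⊗ bᵢ`
with `r` terms and both families linearly independent (`exists_smul_eq_sum_tmul`). Let `N` and `M`
be the saturations of their spans (`exists_saturation`); both have rank `r`, and `L` lies in `N ⊗
M`. Viewing elements of `N ⊗ M` as matrices and taking determinants gives a nonzero map `L^⊗r → ⋀ʳ N
⊗ ⋀ʳ M` that sends `s^⊗r` to `(a₁ ∧ ⋯ ∧ aᵣ) ⊗ (b₁ ∧ ⋯ ∧ bᵣ)`, up to a nonzero constant depending on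
normalization. Integrality of this map is the index inequality `exists_index_pow_le`; that it does
not increase norms is `sqrt_gram_det_mul_le`. Hence `r · deg L ≤ deg N + deg M`, and since the two
ranks agree, division by `r` bounds the normalized degree of `L` by the sum of the slopes of `N` and
`M` (`exists_normalizedDegree_le`). The inequality involving `Ĝ_min` is the same one applied to the
dual of `G`.

Finiteness of the maximal slopes comes from `exists_degree_restrict_le`: some coordinate form on `⋀ʳ
F` is nonzero on `⋀ʳ N`; its values are algebraic integers and it is bounded at every embedding, so
the degree of `N` is bounded in terms of `r` alone. Only finitely many ranks occur. -/

namespace Arakelov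

open TensorProduct

/-! ### Determinants and exterior powers over a commutative ring. -/

section ExteriorAlgebra

variable {R M N : Type*} [CommRing R] [AddCommGroup M] [Module R M] [AddCommGroup N] [Module R N]

/-- Both sides are alternating in the rows of `A`, so it is enough to compare them on distinct
standard basis vectors, that is, on permutation matrices, where each side is a sign times `f v`. -/
theorem alternatingMap_sum_smul {r : ℕ} (f : M [⋀^Fin r]→ₗ[R] N) (A : Matrix (Fin r) (Fin r) R)
    (v : Fin r → M) : f (fun i => ∑ j, A i j • v j) = A.det • f v := by
  have h : f.compLinearMap (Fintype.linearCombination R v) =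
      (LinearMap.toSpanSingleton R N (f v)).compAlternatingMap Matrix.detRowAlternating := by
    refine Module.Basis.ext_alternating (Pi.basisFun R (Fin r)) fun k hk => ?_
    obtain ⟨σ, rfl⟩ : ∃ σ : Equiv.Perm (Fin r), k = σ :=
      ⟨Equiv.ofBijective k (Finite.injective_iff_bijective.mp hk), rfl⟩
    have h1 : (Matrix.detRowAlternating (R := R)) (Pi.basisFun R (Fin r)) = 1 := by
      rw [← Pi.basisFun_det, Module.Basis.det_self]
    have h2 := AlternatingMap.map_perm (Matrix.detRowAlternating (R := R))
      (Pi.basisFun R (Fin r)) σ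
    have h3 : (fun i => Fintype.linearCombination R v (Pi.basisFun R (Fin r) (σ i))) = v ∘ σ := by
      ext i
      simp [Fintype.linearCombination_apply_single]
    rw [AlternatingMap.compLinearMap_apply, h3, AlternatingMap.map_perm]
    refine Eq.trans ?_ (congrArg (fun z : R => z • f v) h2).symm
    rw [h1]
    simp
  exact congrArg (fun g => g A) h

/-- The linear form `v₁ ∧ ⋯ ∧ vᵣ ↦ det (αⱼ (vᵢ))`. -/
noncomputable def detForm {r : ℕ} (α : M →ₗ[R] Fin r → R) : ⋀[R]^r M →ₗ[R] R :=
  exteriorPower.alternatingMapLinearEquiv (Matrix.detRowAlternating.compLinearMap α)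

theorem detForm_ιMulti {r : ℕ} (α : M →ₗ[R] Fin r → R) (v : Fin r → M) :
    detForm α (exteriorPower.ιMulti R r v) = (Matrix.of fun i => α (v i)).det := by
  rw [detForm, exteriorPower.alternatingMapLinearEquiv_apply_ιMulti]
  rfl

/-- Multiply each of the `r` slots of a wedge by `d`, expand in the `a j`, and extract the
determinant. This is the denominator-free form of "`a₁ ∧ ⋯ ∧ aᵣ` spans the top exterior power". -/
theorem smul_eq_detForm_smul {r : ℕ} {α : M →ₗ[R] Fin r → R} {a : Fin r → M} {d : R}
    (h : ∀ x, d • x = ∑ j, α x j • a j) (w : ⋀[R]^r M) :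
    d ^ r • w = detForm α w • exteriorPower.ιMulti R r a := by
  refine ext_induction (p := fun w => d ^ r • w = detForm α w • exteriorPower.ιMulti R r a) w
    (by simp) (fun v => ?_) (fun x y hx hy => by rw [smul_add, hx, hy, map_add, add_smul])
    (fun c x hx => by rw [smul_comm, hx, map_smul, smul_eq_mul, mul_smul])
  have h1 := (exteriorPower.ιMulti R r (M := M)).map_smul_univ (fun _ => d) v
  rw [Finset.prod_const, Finset.card_univ, Fintype.card_fin] at h1
  rw [← h1, detForm_ιMulti]
  simp_rw [h]
  exact alternatingMap_sum_smul (exteriorPower.ιMulti R r) (Matrix.of fun i => α (v i)) a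

/-- A splitting of `M` off a free module induces one of its exterior powers. -/
instance projective_exteriorPower [Module.Finite R M] [Module.Projective R M] (n : ℕ) :
    Module.Projective R (⋀[R]^n M) := by
  obtain ⟨m, s, p, h⟩ := exists_split R M
  refine Module.Projective.of_split (exteriorPower.map n s) (exteriorPower.map n p) ?_
  rw [← exteriorPower.map_comp, h, exteriorPower.map_id]

/-- A form of the Cauchy–Binet formula. -/
theorem det_sum_mul_mem {r n : ℕ} {I J : Ideal R} (u v : Fin n → Fin r → R)
    (hu : ∀ k : Fin r → Fin n, (Matrix.of fun i => u (k i)).det ∈ I)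
    (hv : ∀ k : Fin r → Fin n, (Matrix.of fun i => v (k i)).det ∈ J) :
    (Matrix.of fun i j => ∑ k, u k i * v k j).det ∈ I * J := by
  let b := Pi.basisFun R (Fin n)
  let φ := detForm (Fintype.linearCombination R v)
  have h1 : (Matrix.of fun i j => ∑ k, u k i * v k j).det =
      φ (exteriorPower.ιMulti R r fun i k => u k i) := by
    rw [detForm_ιMulti]
    congr 1
    ext i j
    simp [Fintype.linearCombination_apply]
  -- Expand the wedge of the columns of `u` in the basis indexed by `r`-subsets of `Fin n`: the
  -- coefficients are minors of `u`, and `φ` takes the basis vectors to the matching minors of `v`.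
  rw [h1, ← (b.exteriorPower r).sum_repr (exteriorPower.ιMulti R r fun i k => u k i), map_sum]
  refine Ideal.sum_mem _ fun s _ => ?_
  rw [map_smul, smul_eq_mul]
  refine Ideal.mul_mem_mul ?_ ?_
  · rw [exteriorPower.basis_repr_apply, exteriorPower.ιMultiDual_apply_ιMulti, ← Matrix.det_transpose]
    convert hu (Set.powersetCard.ofFinEmbEquiv.symm s) using 2
    ext i j
    simp [b]
  · rw [exteriorPower.basis_apply, exteriorPower.ιMulti_family, detForm_ιMulti]
    convert hv (Set.powersetCard.ofFinEmbEquiv.symm s) using 2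
    ext i j
    simp [b, Fintype.linearCombination_apply_single]

end ExteriorAlgebra

/-! ### Tensor rank and coordinates over a domain. -/

section Domain

variable {R M N : Type*} [CommRing R] [IsDomain R] [AddCommGroup M] [Module R M]
  [AddCommGroup N] [Module R N]

/-- Take the least number of terms needed to write some nonzero multiple of `x`. A relation among
the `a i` or the `b i` would remove a term; the scalar `c` replaces division by its coefficients. -/
theorem exists_smul_eq_sum_tmul (x : M ⊗[R] N) (hx : x ≠ 0) [Module.IsTorsionFree R (M ⊗[R] N)] :
    ∃ (r : ℕ) (c : R) (a : Fin r → M) (b : Fin r → N), c ≠ 0 ∧ 0 < r ∧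
      LinearIndependent R a ∧ LinearIndependent R b ∧ c • x = ∑ i, a i ⊗ₜ[R] b i := by
  classical
  let P : ℕ → Prop := fun r => ∃ (c : R) (a : Fin r → M) (b : Fin r → N), c ≠ 0 ∧
    c • x = ∑ i, a i ⊗ₜ[R] b i
  have hP : ∃ r, P r := by
    obtain ⟨S, hS⟩ := TensorProduct.exists_finset x
    refine ⟨S.card, 1, fun i => (S.equivFin.symm i).1.1, fun i => (S.equivFin.symm i).1.2,
      one_ne_zero, ?_⟩
    rw [one_smul, Equiv.sum_comp S.equivFin.symm (fun i => i.1.1 ⊗ₜ[R] i.1.2), hS,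
      Finset.sum_coe_sort S (fun i => i.1 ⊗ₜ[R] i.2)]
  obtain ⟨c, a, b, hc, h⟩ := Nat.find_spec hP
  have hmin : ∀ m < Nat.find hP, ¬ P m := fun m hm => Nat.find_min hP hm
  generalize Nat.find hP = r at *
  have hr : 0 < r := by
    rcases Nat.eq_zero_or_pos r with rfl | hr
    · rw [Fin.sum_univ_zero] at h
      exact ((smul_eq_zero.mp h).elim hc hx).elim
    · exact hr
  obtain ⟨r, rfl⟩ : ∃ m, r = m + 1 := ⟨r - 1, by omega⟩
  refine ⟨r + 1, c, a, b, hc, hr, ?_, ?_, h⟩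
  · rw [Fintype.linearIndependent_iff]
    intro t ht j
    by_contra hj
    -- Multiplying by `t j` allows `t j • a j` to be replaced by the other terms of the relation,
    -- which are absorbed into the right-hand factors.
    refine hmin r (by omega) ⟨t j * c, fun i => a (j.succAbove i),
      fun i => t j • b (j.succAbove i) - t (j.succAbove i) • b j, mul_ne_zero hj hc, ?_⟩
    rw [Fin.sum_univ_succAbove _ j] at ht h
    rw [mul_smul, h, smul_add, smul_tmul', eq_neg_of_add_eq_zero_left ht]
    simp only [tmul_sub, Finset.sum_sub_distrib, neg_tmul, sum_tmul, tmul_smul, smul_tmul',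
      Finset.smul_sum]
    abel
  · rw [Fintype.linearIndependent_iff]
    intro t ht j
    by_contra hj
    refine hmin r (by omega) ⟨t j * c,
      fun i => t j • a (j.succAbove i) - t (j.succAbove i) • a j, fun i => b (j.succAbove i),
      mul_ne_zero hj hc, ?_⟩
    rw [Fin.sum_univ_succAbove _ j] at ht h
    rw [mul_smul, h, smul_add, ← tmul_smul, eq_neg_of_add_eq_zero_left ht]
    simp only [sub_tmul, Finset.sum_sub_distrib, tmul_neg, tmul_sum, tmul_smul, smul_tmul',
      Finset.smul_sum]
    abel

/-- Inside a free module, and then over the fraction field, `a` stays independent and so has dual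
coordinates; clearing denominators leaves `d` on the diagonal. -/
theorem exists_coordinates [Module.Finite R M] [Module.Projective R M] {r : ℕ} {a : Fin r → M}
    (ha : LinearIndependent R a) :
    ∃ (α : M →ₗ[R] Fin r → R) (d : R), d ≠ 0 ∧ ∀ i, α (a i) = Pi.single i d := by
  classical
  obtain ⟨m, s, p, hps⟩ := exists_split R M
  let κ := FractionRing R
  let ι : (Fin m → R) →ₗ[R] (Fin m → κ) := LinearMap.compLeft (Algebra.linearMap R κ) (Fin m)
  have hι : Function.Injective ι := fun x y hxy => by
    ext i
    exact IsFractionRing.injective R κ (congrFun hxy i)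
  have hs : Function.Injective s :=
    Function.LeftInverse.injective (g := p) fun x => LinearMap.congr_fun hps x
  have h1 : LinearIndependent R fun i => ι (s (a i)) :=
    (ha.map' s (LinearMap.ker_eq_bot.mpr hs)).map' ι (LinearMap.ker_eq_bot.mpr hι)
  rw [LinearIndependent.iff_fractionRing R κ] at h1
  obtain ⟨g, hg⟩ := LinearMap.exists_leftInverse_of_injective
    (Fintype.linearCombination κ fun i => ι (s (a i)))
    (LinearMap.ker_eq_bot.mpr (h1.fintypeLinearCombination_injective))
  have hg' : ∀ i, g (ι (s (a i))) = Pi.single i 1 := fun i => by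
    have := LinearMap.congr_fun hg (Pi.single i 1)
    simpa [Fintype.linearCombination_apply_single] using this
  -- `d` is a common denominator of the matrix entries of `g`.
  obtain ⟨d, hd⟩ := IsLocalization.exist_integer_multiples_of_finite (nonZeroDivisors R)
    fun k : Fin m × Fin r => g (Pi.single k.1 1) k.2
  choose B hB using hd
  let α : (Fin m → R) →ₗ[R] Fin r → R := Fintype.linearCombination R fun k i => B (k, i)
  have hα : ∀ x i, algebraMap R κ (α x i) = algebraMap R κ d * g (ι x) i := fun x i => by
    have hx : ι x = ∑ k, algebraMap R κ (x k) • (Pi.single k 1 : Fin m → κ) := by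
      refine (pi_eq_sum_univ (ι x)).trans (Finset.sum_congr rfl fun k _ => ?_)
      ext j
      simp [ι, Pi.single_apply, eq_comm]
    rw [hx, map_sum, Finset.sum_apply, Finset.mul_sum]
    simp only [α, Fintype.linearCombination_apply, Finset.sum_apply, Pi.smul_apply, smul_eq_mul,
      map_sum, map_mul, hB, map_smul]
    refine Finset.sum_congr rfl fun k _ => ?_
    rw [show ((d : R) • g (Pi.single k 1) i : κ) = algebraMap R κ d * g (Pi.single k 1) i from
      Algebra.smul_def _ _]
    ring
  refine ⟨α ∘ₗ s, d, nonZeroDivisors.coe_ne_zero d, fun i => ?_⟩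
  ext j
  apply IsFractionRing.injective R κ
  rw [LinearMap.comp_apply, hα, hg']
  by_cases hij : j = i
  · subst hij; simp
  · simp [hij]

end Domain

end Arakelov

namespace Arakelov

open TensorProduct

/-! ### The top exterior power as a rank-one module. -/

section Rank

variable {R M N : Type*} [CommRing R] [IsDomain R] [AddCommGroup M] [Module R M]
  [AddCommGroup N] [Module R N]

/-- By the rank hypothesis `x` and the `a j` satisfy a relation, whose coefficient `g 0` at `x` is
nonzero. Applying `α` determines the other coefficients, and `g 0` cancels. -/
theorem smul_eq_sum_coordinates [Module.Finite R M] [Module.IsTorsionFree R M] {r : ℕ}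
    (hr : Module.finrank R M = r) {a : Fin r → M} (ha : LinearIndependent R a)
    {α : M →ₗ[R] Fin r → R} {d : R} (hα : ∀ i, α (a i) = Pi.single i d) (x : M) :
    d • x = ∑ j, α x j • a j := by
  have h1 : ¬ LinearIndependent R (Fin.cons x a : Fin (r + 1) → M) := fun h => by
    have := h.fintype_card_le_finrank
    rw [hr, Fintype.card_fin] at this
    omega
  obtain ⟨g, hg, i, hi⟩ := Fintype.not_linearIndependent_iff.mp h1
  rw [Fin.sum_univ_succ] at hg
  simp only [Fin.cons_zero, Fin.cons_succ] at hg
  have hg0 : g 0 ≠ 0 := fun h0 => by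
    rw [h0, zero_smul, zero_add] at hg
    have := Fintype.linearIndependent_iff.mp ha _ hg
    exact hi (Fin.cases h0 this i)
  have h2 : ∀ j, g 0 * α x j = -(g j.succ * d) := fun j => by
    have h3 := congrFun (congrArg α hg) j
    simp only [map_add, map_smul, map_sum, hα, map_zero, Pi.add_apply, Pi.smul_apply, smul_eq_mul,
      Finset.sum_apply, Pi.zero_apply] at h3
    rw [Finset.sum_eq_single j (fun k _ hk => by rw [Pi.single_eq_of_ne hk.symm, mul_zero])
      (by simp), Pi.single_eq_same] at h3
    exact eq_neg_of_add_eq_zero_left h3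
  refine smul_right_injective M hg0 ?_
  simp only [Finset.smul_sum, smul_smul, h2]
  simp only [neg_smul, Finset.sum_neg_distrib]
  rw [mul_comm, mul_smul, eq_neg_of_add_eq_zero_left hg, smul_neg, Finset.smul_sum]
  congr 1
  refine Finset.sum_congr rfl fun j _ => ?_
  rw [smul_smul, mul_comm]

omit [IsDomain R] in
theorem detForm_ιMulti_of_single {r : ℕ} {a : Fin r → M} {α : M →ₗ[R] Fin r → R} {d : R}
    (hα : ∀ i, α (a i) = Pi.single i d) : detForm α (exteriorPower.ιMulti R r a) = d ^ r := by
  rw [detForm_ιMulti]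
  have : (Matrix.of fun i => α (a i)) = Matrix.diagonal fun _ => d := by
    ext i j
    rw [Matrix.of_apply, hα, Matrix.diagonal_apply, Pi.single_apply]
    simp [eq_comm]
  rw [this, Matrix.det_diagonal, Finset.prod_const, Finset.card_univ, Fintype.card_fin]

/-- By `smul_eq_detForm_smul` an element of the kernel is killed by `d ^ r`. The determinant line
thus becomes an ideal of `R`, whose norm can be taken later. -/
theorem detForm_injective [Module.Finite R M] [Module.Projective R M] {r : ℕ} {a : Fin r → M}
    {α : M →ₗ[R] Fin r → R} {d : R} (hd : d ≠ 0) (h : ∀ x, d • x = ∑ j, α x j • a j) :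
    Function.Injective (detForm (r := r) α) := by
  rw [injective_iff_map_eq_zero]
  intro w hw
  have h1 := smul_eq_detForm_smul h w
  rw [hw, zero_smul] at h1
  exact (smul_eq_zero.mp h1).resolve_left (pow_ne_zero r hd)

theorem finrank_eq_one_of_injective [Module.Finite R M] {ψ : M →ₗ[R] R} (hψ : Function.Injective ψ) {x : M}
    (hx : x ≠ 0) : Module.finrank R M = 1 := by
  refine le_antisymm ?_ ?_
  · simpa using LinearMap.finrank_le_finrank_of_injective hψ
  · have : Module.IsTorsionFree R M := hψ.moduleIsTorsionFree ψ (fun r x => map_smul ψ r x)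
    have : Nontrivial M := ⟨x, 0, hx⟩
    exact Module.finrank_pos_iff.mpr this

theorem finrank_exteriorPower_finrank [Module.Finite R M] [Module.Projective R M] {r : ℕ}
    (hr : Module.finrank R M = r) {a : Fin r → M} (ha : LinearIndependent R a) :
    Module.finrank R (⋀[R]^r M) = 1 ∧ exteriorPower.ιMulti R r a ≠ 0 := by
  obtain ⟨α, d, hd, hα⟩ := exists_coordinates ha
  have h1 : exteriorPower.ιMulti R r a ≠ 0 := fun h => by
    have h2 := detForm_ιMulti_of_single hα
    rw [h, map_zero] at h2
    exact pow_ne_zero r hd h2.symm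
  exact ⟨finrank_eq_one_of_injective
    (detForm_injective hd (smul_eq_sum_coordinates hr ha hα)) h1, h1⟩

end Rank

/-! ### Powers of ideals in a Dedekind domain. -/

section Dedekind

variable {R : Type*} [CommRing R] [IsDedekindDomain R]

/-- Nonzero ideals cancel, so multiply by `(I ⊔ J) ^ n`. Each term `I ^ m * J ^ (2n - m)` of `(I ⊔
J) ^ (2n)` has an exponent at least `n`. -/
theorem sup_pow_le (I J : Ideal R) (n : ℕ) : (I ⊔ J) ^ n ≤ I ^ n ⊔ J ^ n := by
  by_cases h0 : I ⊔ J = ⊥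
  · obtain ⟨rfl, rfl⟩ := sup_eq_bot_iff.mp h0
    simp
  rw [← Ideal.dvd_iff_le, ← mul_dvd_mul_iff_right (c := (I ⊔ J) ^ n) (pow_ne_zero n h0),
    Ideal.dvd_iff_le, ← pow_add, ← Ideal.add_eq_sup, add_pow, Ideal.sum_eq_sup]
  refine Finset.sup_le fun m hm => le_trans (b := I ^ m * J ^ (n + n - m)) Ideal.mul_le_left ?_
  rw [Finset.mem_range] at hm
  rcases le_or_gt n m with h | h
  · obtain ⟨k, rfl⟩ := Nat.exists_eq_add_of_le h
    rw [pow_add, mul_assoc]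
    refine Ideal.mul_mono le_sup_left ?_
    calc I ^ k * J ^ (n + n - (n + k)) ≤ (I + J) ^ k * (I + J) ^ (n + n - (n + k)) :=
          Ideal.mul_mono (Ideal.pow_right_mono le_sup_left _) (Ideal.pow_right_mono le_sup_right _)
      _ = (I + J) ^ n := by rw [← pow_add]; congr 1; omega
  · obtain ⟨k, hk⟩ : ∃ k, n + n - m = n + k := ⟨n - m, by omega⟩
    rw [hk, pow_add, mul_left_comm]
    refine Ideal.mul_mono le_sup_right ?_
    calc I ^ m * J ^ k ≤ (I + J) ^ m * (I + J) ^ k :=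
          Ideal.mul_mono (Ideal.pow_right_mono le_sup_left _) (Ideal.pow_right_mono le_sup_right _)
      _ = (I + J) ^ n := by rw [← pow_add]; congr 1; omega

/-- In a Dedekind domain, the `n`-th power of an ideal is generated by `n`-th powers. -/
theorem pow_le_of_forall_pow_mem {I A : Ideal R} (n : ℕ) (h : ∀ x ∈ I, x ^ n ∈ A) :
    I ^ n ≤ A := by
  refine Submodule.fg_induction (motive := fun I _ => (∀ x ∈ I, x ^ n ∈ A) → (I : Ideal R) ^ n ≤ A)
    (fun x hx => ?_) (fun I J _ _ hI hJ hIJ => ?_) I (IsNoetherian.noetherian I) h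
  · change Ideal.span {x} ^ n ≤ A
    rw [Ideal.span_singleton_pow, Ideal.span_singleton_le_iff_mem]
    exact hx x (Submodule.mem_span_singleton_self x)
  · exact (sup_pow_le I J n).trans (sup_le (hI fun x hx => hIJ x (Submodule.mem_sup_left hx))
      (hJ fun x hx => hIJ x (Submodule.mem_sup_right hx)))

end Dedekind

/-! ### Indices in rank-one modules as ideal norms. -/

section Index

variable {K : Type*} [Field K] [NumberField K] {D : Type*} [AddCommGroup D] [Module (𝓞 K) D]

/-- Multiplicativity of the index along `(ψ s) ⊆ ψ(D) ⊆ 𝓞 K`, where `ψ` identifies `D` with its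
image. -/
theorem card_quotient_mul_absNorm {ψ : D →ₗ[𝓞 K] 𝓞 K} (hψ : Function.Injective ψ) (s : D) :
    Nat.card (D ⧸ Submodule.span (𝓞 K) {s}) * Ideal.absNorm (LinearMap.range ψ : Ideal (𝓞 K)) =
      Ideal.absNorm (Ideal.span {ψ s}) := by
  have h1 := AddSubgroup.relIndex_mul_index (G := 𝓞 K)
    (H := (Ideal.span {ψ s}).toAddSubgroup)
    (K := (LinearMap.range ψ).toAddSubgroup) (by
      change Ideal.span {ψ s} ≤ LinearMap.range ψ
      rw [Ideal.span_singleton_le_iff_mem]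
      exact LinearMap.mem_range_self ψ s)
  have h2 : Ideal.span {ψ s} = Submodule.map ψ (Submodule.span (𝓞 K) {s}) := by
    rw [Submodule.map_span, Set.image_singleton]
  have h3 : (Ideal.span {ψ s}).toAddSubgroup.relIndex (LinearMap.range ψ).toAddSubgroup =
      Nat.card (D ⧸ Submodule.span (𝓞 K) {s}) := by
    rw [h2, LinearMap.range_eq_map, Submodule.map_toAddSubgroup, Submodule.map_toAddSubgroup,
      AddSubgroup.relIndex_map_map_of_injective _ _ hψ, Submodule.top_toAddSubgroup,
      AddSubgroup.relIndex_top_right]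
    rfl
  rw [h3] at h1
  exact h1

variable [Module.Finite (𝓞 K) D] [Module.IsTorsionFree (𝓞 K) D]

theorem injective_of_finrank_eq_one (hD : Module.finrank (𝓞 K) D = 1) {M : Type*}
    [AddCommGroup M] [Module (𝓞 K) M] [Module.IsTorsionFree (𝓞 K) M] (ψ : D →ₗ[𝓞 K] M) {s : D}
    (hs : ψ s ≠ 0) : Function.Injective ψ := by
  rw [injective_iff_map_eq_zero]
  intro x hx
  obtain ⟨a, b, ha, hab⟩ := HermitianMetric.exists_smul_eq_smul hD x
    (s := s) (by rintro rfl; exact hs (map_zero ψ))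
  have h1 := congrArg ψ hab
  rw [map_smul, map_smul, hx, smul_zero] at h1
  rw [(smul_eq_zero.mp h1.symm).resolve_right hs, zero_smul] at hab
  exact (smul_eq_zero.mp hab).resolve_left ha

end Index

/-! ### Splitting off saturated submodules. -/

section Saturation

variable {K : Type*} [Field K] [NumberField K] {E : Type*} [AddCommGroup E] [Module (𝓞 K) E]
  [Module.Finite (𝓞 K) E] [Module.Projective (𝓞 K) E]

/-- The kernel of an endomorphism of a finitely generated projective module is a direct summand. -/
theorem exists_projection_ker (h : E →ₗ[𝓞 K] E) :
    ∃ p : E →ₗ[𝓞 K] E, (∀ x, p x ∈ LinearMap.ker h) ∧ ∀ x ∈ LinearMap.ker h, p x = x := by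
  -- The range of `h` is a submodule of a projective module over `𝓞 K`, hence projective, so `h` has
  -- a section over it.
  obtain ⟨t, ht⟩ := Module.projective_lifting_property h.rangeRestrict LinearMap.id
    h.surjective_rangeRestrict
  refine ⟨LinearMap.id - t ∘ₗ h.rangeRestrict, fun x => ?_, fun x hx => ?_⟩
  · have h1 := congrArg Subtype.val (LinearMap.congr_fun ht (h.rangeRestrict x))
    simp only [LinearMap.comp_apply, LinearMap.id_apply, LinearMap.codRestrict_apply,
      LinearMap.rangeRestrict] at h1
    simp [h1]
  · have : h.rangeRestrict x = 0 := Subtype.ext hx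
    simp [this]

end Saturation

end Arakelov

/-! ### The index inequality at the finite places. -/

namespace Arakelov

open TensorProduct

variable {K : Type*} [Field K] [NumberField K]
  {F : Type*} [AddCommGroup F] [Module (𝓞 K) F] [Module.Finite (𝓞 K) F] [Module.Projective (𝓞 K) F]
  {G : Type*} [AddCommGroup G] [Module (𝓞 K) G] [Module.Finite (𝓞 K) G] [Module.Projective (𝓞 K) G]

/-- The saturation of the span of a linearly independent family, with its coordinates and a
projection onto it. -/
theorem exists_saturation {r : ℕ} {a : Fin r → F} (ha : LinearIndependent (𝓞 K) a) :
    ∃ (N : Submodule (𝓞 K) F) (α : F →ₗ[𝓞 K] Fin r → 𝓞 K) (d : 𝓞 K) (p : F →ₗ[𝓞 K] F),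
      d ≠ 0 ∧ (∀ i, α (a i) = Pi.single i d) ∧ (∀ i, a i ∈ N) ∧ Module.finrank (𝓞 K) N = r ∧
      (∀ x : N, d • (x : F) = ∑ j, α x j • a j) ∧ (∀ x, p x ∈ N) ∧ ∀ x ∈ N, p x = x := by
  obtain ⟨α, d, hd, hα⟩ := exists_coordinates ha
  -- The saturation is realized as the kernel of an endomorphism, so that `exists_projection_ker`
  -- provides the projection `p`.
  let h : F →ₗ[𝓞 K] F := d • LinearMap.id - Fintype.linearCombination (𝓞 K) a ∘ₗ α
  have hmem : ∀ x, x ∈ LinearMap.ker h ↔ d • x = ∑ j, α x j • a j := fun x => by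
    simp [h, sub_eq_zero, Fintype.linearCombination_apply]
  obtain ⟨p, hp, hp'⟩ := exists_projection_ker h
  have haN : ∀ i, a i ∈ LinearMap.ker h := fun i => by
    rw [hmem, hα, Finset.sum_eq_single i
      (fun j _ hj => by rw [Pi.single_eq_of_ne hj, zero_smul]) (by simp), Pi.single_eq_same]
  refine ⟨LinearMap.ker h, α, d, p, hd, hα, haN, ?_, fun x => (hmem x).mp x.2, hp, hp'⟩
  refine le_antisymm ?_ ?_
  · have hinj : Function.Injective (α ∘ₗ (LinearMap.ker h).subtype) := by
      rw [injective_iff_map_eq_zero]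
      intro x hx
      have h1 := (hmem x).mp x.2
      rw [show α x = 0 from hx] at h1
      simp only [Pi.zero_apply, zero_smul, Finset.sum_const_zero] at h1
      exact Subtype.ext ((smul_eq_zero.mp h1).resolve_left hd)
    simpa using LinearMap.finrank_le_finrank_of_injective hinj
  · have hli : LinearIndependent (𝓞 K) fun i => (⟨a i, haN i⟩ : LinearMap.ker h) :=
      LinearIndependent.of_comp (LinearMap.ker h).subtype ha
    simpa using hli.fintype_card_le_finrank

/-- The bilinear form `x ⊗ y ↦ φ x * ψ y`. -/
noncomputable def tensorForm (φ : F →ₗ[𝓞 K] 𝓞 K) (ψ : G →ₗ[𝓞 K] 𝓞 K) :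
    F ⊗[𝓞 K] G →ₗ[𝓞 K] 𝓞 K :=
  LinearMap.mul' (𝓞 K) (𝓞 K) ∘ₗ TensorProduct.map φ ψ

/-- On `L` the forms `αᵢ ⊗ βⱼ` are `δᵢⱼ l` for one injective form `l`. For `x` in `L` the number `l
x ^ r` is therefore a determinant, and Cauchy–Binet places it in the product of the ideals `JN` and
`JM` that represent `⋀ʳ N` and `⋀ʳ M`. Taking norms of `JL ^ r ≤ JN * JM` compares the indices. -/
theorem exists_index_pow_le (L : Submodule (𝓞 K) (F ⊗[𝓞 K] G))
    (hL : Module.finrank (𝓞 K) L = 1) :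
    ∃ (r : ℕ) (s : L) (N : Submodule (𝓞 K) F) (M : Submodule (𝓞 K) G) (a : Fin r → N)
      (b : Fin r → M), 0 < r ∧ s ≠ 0 ∧ (s : F ⊗[𝓞 K] G) = ∑ i, (a i : F) ⊗ₜ (b i : G) ∧
      Module.finrank (𝓞 K) N = r ∧ Module.finrank (𝓞 K) M = r ∧
      LinearIndependent (𝓞 K) a ∧ LinearIndependent (𝓞 K) b ∧
      Nat.card (L ⧸ Submodule.span (𝓞 K) {s}) ^ r ≤
        Nat.card (⋀[𝓞 K]^r N ⧸ Submodule.span (𝓞 K) {exteriorPower.ιMulti (𝓞 K) r a}) *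
        Nat.card (⋀[𝓞 K]^r M ⧸ Submodule.span (𝓞 K) {exteriorPower.ιMulti (𝓞 K) r b}) := by
  have : Nontrivial L := (Module.finrank_pos_iff (R := 𝓞 K)).mp (by rw [hL]; exact one_pos)
  obtain ⟨x₀, hx₀⟩ := exists_ne (0 : L)
  obtain ⟨r, c, a, b, hc, hr, ha, hb, hab⟩ :=
    exists_smul_eq_sum_tmul (x₀ : F ⊗[𝓞 K] G) (by simpa using hx₀)
  obtain ⟨N, α, d, p, hd, hα, haN, hN, hdN, hp, hp'⟩ := exists_saturation ha
  obtain ⟨M, β, e, q, he, hβ, hbM, hM, heM, hq, hq'⟩ := exists_saturation hb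
  let s : L := c • x₀
  have hs : s ≠ 0 := smul_ne_zero hc hx₀
  have hsab : (s : F ⊗[𝓞 K] G) = ∑ i, a i ⊗ₜ[𝓞 K] b i := hab
  refine ⟨r, s, N, M, fun i => ⟨a i, haN i⟩, fun i => ⟨b i, hbM i⟩, hr, hs, hsab, hN, hM,
    LinearIndependent.of_comp N.subtype ha, LinearIndependent.of_comp M.subtype hb, ?_⟩
  let θ : Fin r → Fin r → F ⊗[𝓞 K] G →ₗ[𝓞 K] 𝓞 K := fun i j =>
    tensorForm (LinearMap.proj i ∘ₗ α) (LinearMap.proj j ∘ₗ β)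
  have hθ : ∀ i j x y, θ i j (x ⊗ₜ y) = α x i * β y j := fun i j x y => rfl
  have hθs : ∀ i j, θ i j s = if i = j then d * e else 0 := fun i j => by
    rw [hsab, map_sum]
    simp only [hθ, hα, hβ, Pi.single_apply, mul_ite, ite_mul, zero_mul, mul_zero]
    simp
  let i₀ : Fin r := ⟨0, hr⟩
  let l : L →ₗ[𝓞 K] 𝓞 K := θ i₀ i₀ ∘ₗ L.subtype
  have hls : l s = d * e := (hθs i₀ i₀).trans (if_pos rfl)
  have hl : Function.Injective l :=
    injective_of_finrank_eq_one hL l (s := s) (by rw [hls]; exact mul_ne_zero hd he)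
  -- Since `L` has rank one, linear identities that hold at `s` hold on all of `L`, after
  -- multiplying by a nonzero scalar and cancelling it. The same argument gives `hpq`.
  have hθl : ∀ (x : L) i j, θ i j x = if i = j then l x else 0 := fun x i j => by
    obtain ⟨c₁, c₂, hc₁, h12⟩ := HermitianMetric.exists_smul_eq_smul hL x hs
    have h1 : c₁ • θ i j x = c₂ • θ i j s := by
      rw [← map_smul, ← map_smul, ← Submodule.coe_smul, ← Submodule.coe_smul, h12]
    have h2 : c₁ • l x = c₂ • l s := by rw [← map_smul, ← map_smul, h12]
    refine smul_right_injective (𝓞 K) hc₁ ?_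
    change c₁ • θ i j x = c₁ • if i = j then l x else 0
    rw [h1, hθs, smul_ite, smul_ite, h2, hls, smul_zero, smul_zero]
  have hpq : ∀ x : L, TensorProduct.map p q (x : F ⊗[𝓞 K] G) = x := fun x => by
    obtain ⟨c₁, c₂, hc₁, h12⟩ := HermitianMetric.exists_smul_eq_smul hL x hs
    refine smul_right_injective (F ⊗[𝓞 K] G) hc₁ ?_
    change c₁ • TensorProduct.map p q (x : F ⊗[𝓞 K] G) = c₁ • (x : F ⊗[𝓞 K] G)
    rw [← map_smul, ← Submodule.coe_smul, h12, Submodule.coe_smul, map_smul, hsab, map_sum]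
    simp only [TensorProduct.map_tmul, hp' _ (haN _), hq' _ (hbM _)]
  let αN := α ∘ₗ N.subtype
  let βM := β ∘ₗ M.subtype
  let JN : Ideal (𝓞 K) := LinearMap.range (detForm (r := r) αN)
  let JM : Ideal (𝓞 K) := LinearMap.range (detForm (r := r) βM)
  let JL : Ideal (𝓞 K) := LinearMap.range l
  have hJ : JL ^ r ≤ JN * JM := by
    -- Only the powers `l x ^ r` are determinants; mixed products of values of `l` need the Dedekind
    -- property.
    refine pow_le_of_forall_pow_mem r ?_
    rintro _ ⟨x, rfl⟩
    obtain ⟨S, hS⟩ := TensorProduct.exists_finset (x : F ⊗[𝓞 K] G)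
    let f : Fin S.card → F := fun k => (S.equivFin.symm k).1.1
    let g : Fin S.card → G := fun k => (S.equivFin.symm k).1.2
    -- The projections give an integral decomposition of `x` with factors in `N` and `M`, so that
    -- the minors below lie in `JN` and `JM`.
    have hx : (x : F ⊗[𝓞 K] G) = ∑ k, p (f k) ⊗ₜ[𝓞 K] q (g k) := by
      rw [← hpq x, hS, map_sum, ← Finset.sum_coe_sort S,
        ← Equiv.sum_comp S.equivFin.symm]
      rfl
    have hdet : l x ^ r = (Matrix.of fun i j => ∑ k, α (p (f k)) i * β (q (g k)) j).det := by
      have h1 : (Matrix.of fun i j => ∑ k, α (p (f k)) i * β (q (g k)) j) =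
          Matrix.diagonal fun _ => l x := by
        ext i j
        rw [Matrix.of_apply, Matrix.diagonal_apply, ← hθl, hx, map_sum]
        rfl
      rw [h1, Matrix.det_diagonal, Finset.prod_const, Finset.card_univ, Fintype.card_fin]
    rw [hdet]
    refine det_sum_mul_mem _ _ (fun k => ?_) fun k => ?_
    · exact ⟨exteriorPower.ιMulti (𝓞 K) r fun i => ⟨p (f (k i)), hp _⟩, detForm_ιMulti _ _⟩
    · exact ⟨exteriorPower.ιMulti (𝓞 K) r fun i => ⟨q (g (k i)), hq _⟩, detForm_ιMulti _ _⟩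
  have hNinj : Function.Injective (detForm (r := r) αN) :=
    detForm_injective (a := fun i => (⟨a i, haN i⟩ : N)) hd fun x =>
      Subtype.ext (by simpa [αN] using hdN x)
  have hMinj : Function.Injective (detForm (r := r) βM) :=
    detForm_injective (a := fun i => (⟨b i, hbM i⟩ : M)) he fun x =>
      Subtype.ext (by simpa [βM] using heM x)
  have hcL := card_quotient_mul_absNorm hl s
  have hcN := card_quotient_mul_absNorm hNinj
    (exteriorPower.ιMulti (𝓞 K) r fun i => (⟨a i, haN i⟩ : N))
  have hcM := card_quotient_mul_absNorm hMinj
    (exteriorPower.ιMulti (𝓞 K) r fun i => (⟨b i, hbM i⟩ : M))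
  rw [detForm_ιMulti_of_single (a := fun i => (⟨a i, haN i⟩ : N)) (α := αN) hα,
    ← Ideal.span_singleton_pow, map_pow] at hcN
  rw [detForm_ιMulti_of_single (a := fun i => (⟨b i, hbM i⟩ : M)) (α := βM) hβ,
    ← Ideal.span_singleton_pow, map_pow] at hcM
  rw [hls, ← Ideal.span_singleton_mul_span_singleton, map_mul] at hcL
  have hJL : Ideal.absNorm JL ≠ 0 := by
    rw [Ne, Ideal.absNorm_eq_zero_iff]
    intro h0
    have h1 : l s ∈ JL := LinearMap.mem_range_self l s
    rw [h0, Ideal.mem_bot, hls] at h1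
    exact mul_ne_zero hd he h1
  have hle : Ideal.absNorm JN * Ideal.absNorm JM ≤ Ideal.absNorm JL ^ r := by
    rw [← map_mul, ← map_pow]
    exact Nat.le_of_dvd (Nat.pos_of_ne_zero (by rw [map_pow]; exact pow_ne_zero r hJL))
      (Ideal.absNorm_dvd_absNorm_of_le hJ)
  -- After multiplication by the norm of `JL ^ r`, the left side is the norm of `(d * e) ^ r`, which
  -- also equals the two indices on the right times the norms of `JN` and `JM`.
  refine Nat.le_of_mul_le_mul_right ?_ (Nat.pos_of_ne_zero (pow_ne_zero r hJL))
  rw [← mul_pow, hcL, mul_pow, ← hcN, ← hcM, mul_mul_mul_comm]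
  exact Nat.mul_le_mul_left _ hle

end Arakelov

namespace Arakelov

open TensorProduct

open scoped ComplexOrder

set_option linter.style.haveILetI false

/-! ### Determinant inequalities for positive semidefinite matrices. -/

section Gram

variable {n : Type*} [Fintype n] [DecidableEq n]

/-- Each eigenvalue is nonnegative, hence at most their sum. The sharper constant of the
arithmetic–geometric mean inequality is not needed. -/
theorem _root_.Matrix.PosSemidef.det_re_le_trace_re_pow {A : Matrix n n ℂ} (hA : A.PosSemidef) :
    A.det.re ≤ A.trace.re ^ Fintype.card n := by
  have h0 := hA.eigenvalues_nonneg
  have h1 : A.det.re = ∏ i, hA.1.eigenvalues i := by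
    rw [hA.1.det_eq_prod_eigenvalues]
    exact_mod_cast Complex.ofReal_re _
  have h2 : A.trace.re = ∑ i, hA.1.eigenvalues i := by
    rw [hA.1.trace_eq_sum_eigenvalues]
    exact_mod_cast Complex.ofReal_re _
  rw [h1, h2, ← Finset.card_univ, ← Finset.prod_const]
  exact Finset.prod_le_prod (fun i _ => h0 i) fun i _ =>
    Finset.single_le_sum (fun j _ => h0 j) (Finset.mem_univ i)

/-- With `Bᵀ = S* S`, the matrix `S A S*` is positive semidefinite, has determinant `det A * det B`,
and has trace `tr (A Bᵀ) = ∑ Aᵢⱼ Bᵢⱼ`. -/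
theorem _root_.Matrix.PosSemidef.det_re_mul_det_re_le {A B : Matrix n n ℂ} (hA : A.PosSemidef)
    (hB : B.PosSemidef) :
    A.det.re * B.det.re ≤ (∑ i, ∑ j, A i j * B i j).re ^ Fintype.card n := by
  obtain ⟨S, hS⟩ : ∃ S : Matrix n n ℂ, B.transpose = S.conjTranspose * S := by
    open scoped MatrixOrder in
    exact CStarAlgebra.nonneg_iff_eq_star_mul_self.mp hB.transpose.nonneg
  have h1 := (hA.mul_mul_conjTranspose_same S).det_re_le_trace_re_pow
  have hB0 : B.det.im = 0 := (Complex.nonneg_iff.mp hB.det_nonneg).2.symm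
  have h2 : (S * A * S.conjTranspose).det = A.det * B.det := by
    rw [← Matrix.det_transpose B, hS, Matrix.det_mul, Matrix.det_mul, Matrix.det_mul]
    ring
  have h3 : (S * A * S.conjTranspose).trace = ∑ i, ∑ j, A i j * B i j := by
    rw [Matrix.mul_assoc, Matrix.trace_mul_comm, Matrix.mul_assoc, ← hS]
    rfl
  rw [h2, h3, Complex.mul_re, hB0, mul_zero, sub_zero] at h1
  exact h1

omit [DecidableEq n] in
theorem posSemidef_gram_core {V : Type*} [AddCommGroup V] [Module ℂ V]
    (c : InnerProductSpace.Core ℂ V) (v : n → V) :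
    (Matrix.of fun i j => c.inner (v i) (v j)).PosSemidef := by
  letI := c.toNormedAddCommGroup
  letI := InnerProductSpace.ofCore c.toCore
  exact Matrix.posSemidef_gram ℂ v

end Gram

namespace HermitianMetric

variable {K : Type*} [Field K]

/-! ### Archimedean norms of wedges and tensors. -/

section Norms

variable {E F : Type*} [AddCommGroup E] [Module (𝓞 K) E] [AddCommGroup F] [Module (𝓞 K) F]

/-- The Gram matrix of a family of elements of `E` in `E_σ`. -/
noncomputable def gram (h : HermitianMetric K E) (σ : K →+* ℂ) {r : ℕ} (v : Fin r → E) :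
    Matrix (Fin r) (Fin r) ℂ :=
  Matrix.of fun i j => (h.core σ).inner (toFiber σ (v i)) (toFiber σ (v j))

theorem gram_posSemidef (h : HermitianMetric K E) (σ : K →+* ℂ) {r : ℕ} (v : Fin r → E) :
    (h.gram σ v).PosSemidef :=
  posSemidef_gram_core (h.core σ) fun i => toFiber σ (v i)

theorem gram_restrict [NumberField K] (h : HermitianMetric K E) (N : Submodule (𝓞 K) E)
    (σ : K →+* ℂ) {r : ℕ} (v : Fin r → N) :
    (h.restrict N).gram σ v = h.gram σ fun i => (v i : E) := rfl

theorem norm_restrict [NumberField K] (h : HermitianMetric K E) (N : Submodule (𝓞 K) E)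
    (σ : K →+* ℂ) (x : N) : (h.restrict N).norm σ x = h.norm σ (x : E) := rfl

theorem norm_zero (h : HermitianMetric K E) (σ : K →+* ℂ) : h.norm σ 0 = 0 := by
  have : (h.core σ).inner (0 : Fiber σ E) 0 = 0 := by simpa using (h.core σ).smul_left 0 0 0
  rw [norm, toFiber_zero, this, Complex.zero_re, Real.sqrt_zero]

theorem norm_nonneg (h : HermitianMetric K E) (σ : K →+* ℂ) (e : E) : 0 ≤ h.norm σ e :=
  Real.sqrt_nonneg _

theorem norm_exterior_ιMulti [Module.Finite (𝓞 K) E] [Module.Projective (𝓞 K) E]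
    (h : HermitianMetric K E) (σ : K →+* ℂ) {r : ℕ} (v : Fin r → E) :
    (h.exterior r).norm σ (exteriorPower.ιMulti (𝓞 K) r v) = √(h.gram σ v).det.re := by
  letI := embAlgebra σ
  have : ((h.exterior r).core σ).inner (toFiber σ (exteriorPower.ιMulti (𝓞 K) r v))
      (toFiber σ (exteriorPower.ιMulti (𝓞 K) r v)) = (h.gram σ v).det := by
    change gramForm (V := ℂ ⊗[𝓞 K] E) (h.core σ) r
      (extBaseChange (𝓞 K) ℂ E r ((1 : ℂ) ⊗ₜ exteriorPower.ιMulti (𝓞 K) r v))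
      (extBaseChange (𝓞 K) ℂ E r ((1 : ℂ) ⊗ₜ exteriorPower.ιMulti (𝓞 K) r v)) = _
    rw [extBaseChange_tmul_ιMulti, one_smul]
    exact gramForm_ιMulti (V := ℂ ⊗[𝓞 K] E) (h.core σ) r _ _
  rw [norm, this]

theorem toFiber_sum {ι : Type*} (S : Finset ι) (v : ι → E) (σ : K →+* ℂ) :
    toFiber σ (∑ i ∈ S, v i) = ∑ i ∈ S, toFiber σ (v i) :=
  map_sum (AddMonoidHom.mk' (toFiber σ) (toFiber_add σ)) v S

theorem norm_tensor_sum_sq (h : HermitianMetric K E) (k : HermitianMetric K F) (σ : K →+* ℂ) {r : ℕ}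
    (a : Fin r → E) (b : Fin r → F) :
    (h.tensor k).norm σ (∑ i, a i ⊗ₜ b i) ^ 2 =
      (∑ i, ∑ j, h.gram σ a i j * k.gram σ b i j).re := by
  have sum_left : ∀ (v : Fin r → Fiber σ (E ⊗[𝓞 K] F)) w,
      ((h.tensor k).core σ).inner (∑ i, v i) w = ∑ i, ((h.tensor k).core σ).inner (v i) w :=
    fun v w => map_sum (AddMonoidHom.mk' (fun z => ((h.tensor k).core σ).inner z w)
      fun x y => ((h.tensor k).core σ).add_left x y w) v _
  have sum_right : ∀ (v : Fin r → Fiber σ (E ⊗[𝓞 K] F)) w,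
      ((h.tensor k).core σ).inner w (∑ i, v i) = ∑ i, ((h.tensor k).core σ).inner w (v i) :=
    fun v w => map_sum (AddMonoidHom.mk' (fun z => ((h.tensor k).core σ).inner w z)
      fun x y => core_add_right _ w x y) v _
  refine (Real.sq_sqrt (((h.tensor k).core σ).re_inner_nonneg _)).trans ?_
  change (((h.tensor k).core σ).inner _ _).re = _
  rw [toFiber_sum, sum_left]
  simp only [sum_right]
  rfl

/-- The archimedean counterpart of `exists_index_pow_le`: by `norm_tensor_sum_sq` the squared tensor
norm is the entrywise pairing of the two Gram matrices, so the matrix inequality applies. -/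
theorem sqrt_gram_det_mul_le (f : HermitianMetric K E) (g : HermitianMetric K F) (σ : K →+* ℂ)
    {r : ℕ} (a : Fin r → E) (b : Fin r → F) :
    √(f.gram σ a).det.re * √(g.gram σ b).det.re ≤
      (f.tensor g).norm σ (∑ i, a i ⊗ₜ b i) ^ r := by
  have h1 := (f.gram_posSemidef σ a).det_re_mul_det_re_le (g.gram_posSemidef σ b)
  rw [Fintype.card_fin] at h1
  have h2 : 0 ≤ (f.gram σ a).det.re :=
    (RCLike.nonneg_iff.mp (f.gram_posSemidef σ a).det_nonneg).1
  rw [← Real.sqrt_mul h2]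
  refine Real.sqrt_le_iff.mpr ⟨pow_nonneg (norm_nonneg _ _ _) r, ?_⟩
  rw [← pow_mul, mul_comm r 2, pow_mul, norm_tensor_sum_sq]
  exact h1

/-- Linear forms are bounded at every archimedean place. -/
theorem exists_norm_le_mul_norm [Module.Finite (𝓞 K) E] (h : HermitianMetric K E) (σ : K →+* ℂ)
    (φ : E →ₗ[𝓞 K] 𝓞 K) : ∃ C : ℝ, 0 < C ∧ ∀ e, ‖σ (φ e)‖ ≤ C * h.norm σ e := by
  letI := (h.core σ).toNormedAddCommGroup
  letI := InnerProductSpace.ofCore (h.core σ).toCore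
  let u := riesz (h.core σ) (dualFiber σ (toFiber σ φ))
  -- Cauchy–Schwarz against the Riesz vector; the `+ 1` keeps the constant positive when `φ` is
  -- zero, since its logarithm is taken later.
  refine ⟨‖u‖ + 1, by positivity, fun e => ?_⟩
  have h1 : σ (φ e) = inner ℂ u (toFiber σ e) := by
    rw [← dualFiber_toFiber, ← inner_riesz (h.core σ)]
  have h2 : h.norm σ e = ‖toFiber σ e‖ := rfl
  rw [h1, h2]
  exact (norm_inner_le_norm _ _).trans
    (mul_le_mul_of_nonneg_right (by linarith) (by positivity))

end Norms

/-! ### Degrees computed from independent families. -/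

section Degrees

variable [NumberField K] {E : Type*} [AddCommGroup E] [Module (𝓞 K) E] [Module.Finite (𝓞 K) E]
  [Module.Projective (𝓞 K) E]

theorem degree_eq (h : HermitianMetric K E) {r : ℕ} (hr : Module.finrank (𝓞 K) E = r)
    {a : Fin r → E} (ha : LinearIndependent (𝓞 K) a) :
    h.degree = Real.log (Nat.card (⋀[𝓞 K]^r E ⧸
        Submodule.span (𝓞 K) {exteriorPower.ιMulti (𝓞 K) r a})) -
      ∑ σ : K →+* ℂ, Real.log (√(h.gram σ a).det.re) := by
  subst hr
  obtain ⟨h1, h2⟩ := finrank_exteriorPower_finrank rfl ha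
  rw [degree, lineDegree_eq _ h1 h2]
  simp only [norm_exterior_ιMulti]

theorem sqrt_gram_det_pos (h : HermitianMetric K E) (σ : K →+* ℂ) {r : ℕ}
    (hr : Module.finrank (𝓞 K) E = r) {a : Fin r → E} (ha : LinearIndependent (𝓞 K) a) :
    0 < √(h.gram σ a).det.re := by
  rw [← norm_exterior_ιMulti]
  exact (norm_nonneg _ _ _).lt_of_ne'
    (norm_ne_zero _ _ (finrank_exteriorPower_finrank hr ha).2)

/-- The degree is defined through `⋀¹ E`; the isomorphism with `E` preserves the index, and a `1 ×
1` Gram determinant is a squared norm. -/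
theorem degree_eq_of_finrank_eq_one (h : HermitianMetric K E)
    (hE : Module.finrank (𝓞 K) E = 1) {s : E} (hs : s ≠ 0) :
    h.degree = Real.log (Nat.card (E ⧸ Submodule.span (𝓞 K) {s})) -
      ∑ σ : K →+* ℂ, Real.log (h.norm σ s) := by
  have hli : LinearIndependent (𝓞 K) fun _ : Fin 1 => s := by
    rw [Fintype.linearIndependent_iff]
    intro g hg i
    rw [Fin.sum_univ_one] at hg
    rw [Subsingleton.elim i 0]
    exact (smul_eq_zero.mp hg).resolve_right hs
  have h1 : Nat.card (⋀[𝓞 K]^1 E ⧸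
      Submodule.span (𝓞 K) {exteriorPower.ιMulti (𝓞 K) 1 fun _ : Fin 1 => s}) =
      Nat.card (E ⧸ Submodule.span (𝓞 K) {s}) := by
    refine Nat.card_congr (Submodule.Quotient.equiv _ _ (exteriorPower.oneEquiv (𝓞 K) E) ?_).toEquiv
    rw [Submodule.map_span, Set.image_singleton]
    congr 2
    simp
  rw [h.degree_eq hE hli, h1]
  congr 1
  refine Finset.sum_congr rfl fun σ _ => ?_
  rw [Matrix.det_fin_one]
  rfl

end Degrees

end HermitianMetric

end Arakelov

/-! ### Slope inequalities and finiteness of the suprema. -/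

namespace Arakelov

open TensorProduct

theorem exists_linearForm_ne_zero (R : Type*) {M : Type*} [CommRing R] [AddCommGroup M] [Module R M]
    [Module.Finite R M] [Module.Projective R M] {x : M} (hx : x ≠ 0) :
    ∃ φ : M →ₗ[R] R, φ x ≠ 0 := by
  obtain ⟨m, ι, p, hp⟩ := exists_split R M
  by_contra! h
  have h1 : ι x = 0 := funext fun j => h (LinearMap.proj j ∘ₗ ι)
  have h2 := LinearMap.congr_fun hp x
  rw [LinearMap.comp_apply, h1, map_zero] at h2
  exact hx h2.symm

namespace HermitianMetric

variable {K : Type*} [Field K] [NumberField K]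
  {F : Type*} [AddCommGroup F] [Module (𝓞 K) F] [Module.Finite (𝓞 K) F] [Module.Projective (𝓞 K) F]
  {G : Type*} [AddCommGroup G] [Module (𝓞 K) G] [Module.Finite (𝓞 K) G] [Module.Projective (𝓞 K) G]

/-- A rank one submodule of `F ⊗ G` is dominated by submodules of `F` and `G` of equal rank. -/
theorem exists_normalizedDegree_le (f : HermitianMetric K F) (g : HermitianMetric K G)
    (L : Submodule (𝓞 K) (F ⊗[𝓞 K] G)) (hL : Module.finrank (𝓞 K) L = 1) :
    ∃ (N : Submodule (𝓞 K) F) (M : Submodule (𝓞 K) G), 0 < Module.finrank (𝓞 K) N ∧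
      0 < Module.finrank (𝓞 K) M ∧
      ((f.tensor g).restrict L).normalizedDegree ≤ (f.restrict N).slope + (g.restrict M).slope := by
  obtain ⟨r, s, N, M, a, b, hr, hs, hsab, hN, hM, ha, hb, hcard⟩ := exists_index_pow_le L hL
  refine ⟨N, M, hN ▸ hr, hM ▸ hr, ?_⟩
  have hfin := finite_quotient hL hs
  have hfinN := finite_quotient (finrank_exteriorPower_finrank hN ha).1
    (finrank_exteriorPower_finrank hN ha).2
  have hfinM := finite_quotient (finrank_exteriorPower_finrank hM hb).1
    (finrank_exteriorPower_finrank hM hb).2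
  have hlog : r * Real.log (Nat.card (L ⧸ Submodule.span (𝓞 K) {s})) ≤
      Real.log (Nat.card (⋀[𝓞 K]^r N ⧸ Submodule.span (𝓞 K) {exteriorPower.ιMulti (𝓞 K) r a})) +
      Real.log (Nat.card (⋀[𝓞 K]^r M ⧸ Submodule.span (𝓞 K) {exteriorPower.ιMulti (𝓞 K) r b})) := by
    rw [← Real.log_pow, ← Real.log_mul (Nat.cast_ne_zero.mpr Nat.card_pos.ne')
      (Nat.cast_ne_zero.mpr Nat.card_pos.ne')]
    refine Real.log_le_log (pow_pos (Nat.cast_pos.mpr Nat.card_pos) r) ?_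
    exact_mod_cast hcard
  have hσ : ∀ σ : K →+* ℂ, Real.log (√((f.restrict N).gram σ a).det.re) +
      Real.log (√((g.restrict M).gram σ b).det.re) ≤
      r * Real.log (((f.tensor g).restrict L).norm σ s) := fun σ => by
    have h1 := (f.restrict N).sqrt_gram_det_pos σ hN ha
    have h2 := (g.restrict M).sqrt_gram_det_pos σ hM hb
    rw [← Real.log_mul h1.ne' h2.ne', ← Real.log_pow]
    refine Real.log_le_log (mul_pos h1 h2) ?_
    rw [gram_restrict, gram_restrict, norm_restrict, hsab]
    exact sqrt_gram_det_mul_le f g σ _ _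
  have hsum := Finset.sum_le_sum fun σ (_ : σ ∈ Finset.univ) => hσ σ
  rw [Finset.sum_add_distrib, ← Finset.mul_sum] at hsum
  -- The norms enter the degree with a minus sign, so `hlog` and the opposite estimate `hsum` add
  -- up.
  have hdeg : r * ((f.tensor g).restrict L).degree ≤
      (f.restrict N).degree + (g.restrict M).degree := by
    rw [degree_eq_of_finrank_eq_one _ hL hs, degree_eq _ hN ha, degree_eq _ hM hb]
    linarith
  have hn : (0 : ℝ) < Module.finrank ℚ K := Nat.cast_pos.mpr Module.finrank_pos
  have hr' : (0 : ℝ) < r := Nat.cast_pos.mpr hr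
  rw [slope, slope, normalizedDegree, normalizedDegree, normalizedDegree, hN, hM, ← add_div,
    ← add_div, le_div_iff₀ hr', div_mul_eq_mul_div]
  gcongr
  linarith

/-- Embed `⋀ʳ F` in a free module and choose a coordinate `ψ` that is nonzero on `w = a₁ ∧ ⋯ ∧ aᵣ`.
The index of `w` is at most the absolute norm `∏ ‖σ (ψ w)‖`, and each factor is at most a constant
times the norm of `w`; in the degree the norms of `w` cancel. -/
theorem exists_degree_restrict_le (f : HermitianMetric K F) (r : ℕ) :
    ∃ B : ℝ, 0 ≤ B ∧ ∀ N : Submodule (𝓞 K) F, Module.finrank (𝓞 K) N = r →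
      (f.restrict N).degree ≤ B := by
  obtain ⟨m, ι, p, hp⟩ := exists_split (𝓞 K) (⋀[𝓞 K]^r F)
  choose C hC0 hC using fun (j : Fin m) σ =>
    (f.exterior r).exists_norm_le_mul_norm σ (LinearMap.proj j ∘ₗ ι)
  -- The useful coordinate `j` depends on `N`; summing absolute values over all coordinates covers
  -- every case.
  refine ⟨∑ j, |∑ σ, Real.log (C j σ)|, Finset.sum_nonneg fun j _ => abs_nonneg _,
    fun N hN => ?_⟩
  obtain ⟨a, ha⟩ := exists_linearIndependent_of_le_finrank hN.ge
  obtain ⟨h1, h2⟩ := finrank_exteriorPower_finrank hN ha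
  let w := exteriorPower.ιMulti (𝓞 K) r a
  let x := exteriorPower.map r N.subtype w
  have hx : x = exteriorPower.ιMulti (𝓞 K) r fun i => (a i : F) :=
    exteriorPower.map_apply_ιMulti _ _
  have hnorm : ∀ σ, (f.exterior r).norm σ x = √((f.restrict N).gram σ a).det.re := fun σ => by
    rw [hx, norm_exterior_ιMulti, gram_restrict]
  have hpos : ∀ σ, 0 < (f.exterior r).norm σ x := fun σ => by
    rw [hnorm]
    exact (f.restrict N).sqrt_gram_det_pos σ hN ha
  -- The image of `w` in `⋀ʳ F` is nonzero because its norm at any embedding equals the positive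
  -- norm of `w`.
  have hx0 : x ≠ 0 := fun h0 => by
    obtain ⟨σ⟩ : Nonempty (K →+* ℂ) := inferInstance
    have := hpos σ
    rw [h0, norm_zero] at this
    exact lt_irrefl _ this
  obtain ⟨j, hj⟩ : ∃ j, ι x j ≠ 0 := by
    by_contra! h0
    have h3 : ι x = 0 := funext h0
    have h4 := LinearMap.congr_fun hp x
    rw [LinearMap.comp_apply, h3, map_zero] at h4
    exact hx0 h4.symm
  let ψ : ⋀[𝓞 K]^r N →ₗ[𝓞 K] 𝓞 K := LinearMap.proj j ∘ₗ ι ∘ₗ exteriorPower.map r N.subtype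
  have hψw : ψ w ≠ 0 := hj
  have hψ : Function.Injective ψ := injective_of_finrank_eq_one h1 ψ (s := w) hψw
  have hcard := card_quotient_mul_absNorm hψ w
  have hfin := finite_quotient h1 h2
  have habs : Ideal.absNorm (Ideal.span {ψ w}) ≠ 0 := by
    simpa [Ideal.absNorm_eq_zero_iff] using hψw
  have hle : Nat.card (⋀[𝓞 K]^r N ⧸ Submodule.span (𝓞 K) {w}) ≤
      Ideal.absNorm (Ideal.span {ψ w}) := by
    rw [← hcard] at habs ⊢
    exact Nat.le_mul_of_pos_right _ (Nat.pos_of_ne_zero (right_ne_zero_of_mul habs))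
  have hlog : Real.log (Nat.card (⋀[𝓞 K]^r N ⧸ Submodule.span (𝓞 K) {w})) ≤
      ∑ σ : K →+* ℂ, Real.log ‖σ (ψ w)‖ := by
    rw [sum_log_embeddings _ hψw]
    exact Real.log_le_log (Nat.cast_pos.mpr Nat.card_pos) (Nat.cast_le.mpr hle)
  have hσ : ∀ σ : K →+* ℂ, Real.log ‖σ (ψ w)‖ ≤
      Real.log (C j σ) + Real.log (√((f.restrict N).gram σ a).det.re) := fun σ => by
    rw [← hnorm, ← Real.log_mul (hC0 j σ).ne' (hpos σ).ne']
    refine Real.log_le_log (norm_pos_iff.mpr ?_) (hC j σ x)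
    simpa using hψw
  have hsum := Finset.sum_le_sum fun σ (_ : σ ∈ Finset.univ) => hσ σ
  rw [Finset.sum_add_distrib] at hsum
  rw [degree_eq _ hN ha]
  calc _ ≤ ∑ σ, Real.log (C j σ) := by linarith
    _ ≤ |∑ σ, Real.log (C j σ)| := le_abs_self _
    _ ≤ _ := Finset.single_le_sum (f := fun j => |∑ σ, Real.log (C j σ)|)
      (fun j _ => abs_nonneg _) (Finset.mem_univ j)

/-- The maximal slope is finite. -/
theorem bddAbove_subbundleSlopes (f : HermitianMetric K F) : BddAbove f.subbundleSlopes := by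
  choose B hB0 hB using f.exists_degree_restrict_le
  -- The rank of `N` is at most that of `F`. Since `B r` is nonnegative, it survives division by the
  -- rank and by `[K : ℚ]`.
  refine ⟨∑ r ∈ Finset.range (Module.finrank (𝓞 K) F + 1), B r, ?_⟩
  rintro _ ⟨N, hN, rfl⟩
  have h1 : (f.restrict N).slope ≤ B (Module.finrank (𝓞 K) N) := by
    have hn : (1 : ℝ) ≤ Module.finrank ℚ K := by
      exact_mod_cast (Module.finrank_pos : 0 < Module.finrank ℚ K)
    have hr : (1 : ℝ) ≤ Module.finrank (𝓞 K) N := by exact_mod_cast hN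
    rw [slope, normalizedDegree, div_div, div_le_iff₀ (by positivity)]
    refine (hB _ N rfl).trans (le_mul_of_one_le_right (hB0 _) ?_)
    nlinarith
  refine h1.trans (Finset.single_le_sum (fun r _ => hB0 r) ?_)
  rw [Finset.mem_range, Nat.lt_succ_iff]
  exact Submodule.finrank_le N

theorem finrank_dual_pos (hG : 0 < Module.finrank (𝓞 K) G) :
    0 < Module.finrank (𝓞 K) (Module.Dual (𝓞 K) G) := by
  have : Nontrivial G := (Module.finrank_pos_iff (R := 𝓞 K)).mp hG
  obtain ⟨x, hx⟩ := exists_ne (0 : G)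
  obtain ⟨φ, hφ⟩ := exists_linearForm_ne_zero (𝓞 K) hx
  have : Nontrivial (Module.Dual (𝓞 K) G) := ⟨φ, 0, fun h => hφ (LinearMap.congr_fun h x)⟩
  exact (Module.finrank_pos_iff (R := 𝓞 K)).mpr this

/-- A real supremum can be bounded through `csSup_le` only over a nonempty set. The span of a pure
tensor `x ⊗ y` serves; a product of linear forms shows that it is nonzero. -/
theorem subLineDegrees_tensor_nonempty (f : HermitianMetric K F) (g : HermitianMetric K G)
    (hF : 0 < Module.finrank (𝓞 K) F) (hG : 0 < Module.finrank (𝓞 K) G) :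
    (f.tensor g).subLineDegrees.Nonempty := by
  have : Nontrivial F := (Module.finrank_pos_iff (R := 𝓞 K)).mp hF
  have : Nontrivial G := (Module.finrank_pos_iff (R := 𝓞 K)).mp hG
  obtain ⟨x, hx⟩ := exists_ne (0 : F)
  obtain ⟨y, hy⟩ := exists_ne (0 : G)
  obtain ⟨φ, hφ⟩ := exists_linearForm_ne_zero (𝓞 K) hx
  obtain ⟨ψ, hψ⟩ := exists_linearForm_ne_zero (𝓞 K) hy
  have hxy : x ⊗ₜ[𝓞 K] y ≠ 0 := fun h => by
    have h1 : tensorForm φ ψ (x ⊗ₜ[𝓞 K] y) = φ x * ψ y := rfl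
    rw [h, map_zero] at h1
    exact mul_ne_zero hφ hψ h1.symm
  refine ⟨_, Submodule.span (𝓞 K) {x ⊗ₜ[𝓞 K] y}, ?_, rfl⟩
  rw [← (LinearEquiv.toSpanNonzeroSingleton (𝓞 K) _ _ hxy).finrank_eq, Module.finrank_self]

theorem subLineDegrees_tensor_le (f : HermitianMetric K F) (g : HermitianMetric K G) :
    f.maxSlope + g.maxSlope ∈ upperBounds (f.tensor g).subLineDegrees := by
  rintro _ ⟨L, hL, rfl⟩
  obtain ⟨N, M, hN, hM, h⟩ := exists_normalizedDegree_le f g L hL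
  exact h.trans (add_le_add (le_csSup f.bddAbove_subbundleSlopes ⟨N, hN, rfl⟩)
    (le_csSup g.bddAbove_subbundleSlopes ⟨M, hM, rfl⟩))

theorem upperDegree_tensor_le (f : HermitianMetric K F) (g : HermitianMetric K G)
    (hF : 0 < Module.finrank (𝓞 K) F) (hG : 0 < Module.finrank (𝓞 K) G) :
    (f.tensor g).upperDegree ≤ f.maxSlope + g.maxSlope :=
  csSup_le (subLineDegrees_tensor_nonempty f g hF hG) (subLineDegrees_tensor_le f g)

end HermitianMetric

end Arakelov

theorem proposition3 {K : Type*} [Field K] [NumberField K]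
    {F : Type*} [AddCommGroup F] [Module (𝓞 K) F] [Module.Finite (𝓞 K) F]
    [Module.Projective (𝓞 K) F]
    {G : Type*} [AddCommGroup G] [Module (𝓞 K) G] [Module.Finite (𝓞 K) G]
    [Module.Projective (𝓞 K) G]
    (f : Arakelov.HermitianMetric K F) (g : Arakelov.HermitianMetric K G)
    (hF : 0 < Module.finrank (𝓞 K) F) (hG : 0 < Module.finrank (𝓞 K) G) :
    -- the suprema that define the invariants below are finite
    (BddAbove f.subbundleSlopes ∧ BddAbove g.subbundleSlopes ∧
      BddAbove g.dual.subbundleSlopes ∧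
      BddAbove (f.tensor g.dual).subLineDegrees ∧ BddAbove (f.tensor g).subLineDegrees) ∧
    -- the two inequalities
    (f.tensor g.dual).upperDegree ≤ f.maxSlope - g.minSlope ∧
    (f.tensor g).upperDegree ≤ f.maxSlope + g.maxSlope := by
  refine ⟨⟨f.bddAbove_subbundleSlopes, g.bddAbove_subbundleSlopes, g.dual.bddAbove_subbundleSlopes,
    ⟨_, f.subLineDegrees_tensor_le g.dual⟩, ⟨_, f.subLineDegrees_tensor_le g⟩⟩, ?_,
    f.upperDegree_tensor_le g hF hG⟩
  -- Unfolding the minimal slope turns the first inequality into the second one for `g.dual`.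
  rw [Arakelov.HermitianMetric.minSlope, sub_neg_eq_add]
  exact f.upperDegree_tensor_le g.dual hF (Arakelov.HermitianMetric.finrank_dual_pos hG)
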